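/- Let $G_{4,2}$ be the Grassmannian of $2$-dimensional complex subspaces of $\mathbb C^4$ with its standard smooth structure. For a basis of $L\in G_{4,2}$ let $P^{I}(L)$, $I=\{i<j\}\subset\{1,2,3,4\}$, be its Plücker coordinates, let $\Lambda_{I}=e_i+e_j\in\mathbb R^4$, and let $\mu:G_{4,2}\to\mathbb R^4$, $$\mu(L)=\frac{1}{\sum_I|P^I(L)|^2}\sum_I|P^I(L)|^2\Lambda_I ,$$ be the moment map of the canonical $T^4$-action; its image is the hypersimplex $\Delta_{4,2}$. For a set $\sigma$ of pairs put $W_\sigma=\{L\in G_{4,2}: P^I(L)\neq 0 \text{ iff } I\in\sigma\}$. When $W_\sigma\neq\emptyset$, the convex hull $P_\sigma$ of $\{\Lambda_I: I\in\sigma\}$ is called an admissible polytope. Writing $\mathring{P}_\sigma$ for its relative interior, a chamber is a non-empty set $C_\omega=\bigcap_{\sigma\in\omega}\mathring{P}_\sigma$, where $\omega$ is a family of $\sigma$ with $W_\sigma\ne\emptyset$ and $C_\omega\cap\mathring{P}_\sigma=\emptyset$ for every other $\sigma$ with $W_\sigma\neq\emptyset$. The chambers of maximal dimension are those of dimension $3$.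 For every point $\mathbf x$ of a chamber of maximal dimension, $M^5_{\mathbf x}=\mu^{-1}(\mathbf x)$ is an embedded smooth submanifold of $G_{4,2}$ of real dimension $5$. If $\mathbf x$ and $\mathbf y$ are points of chambers of maximal dimension (the same chamber or two different ones), then $M^5_{\mathbf x}$ and $M^5_{\mathbf y}$ are diffeomorphic. -/

import Mathlib

open scoped Manifold ContDiff

noncomputable section

namespace Gr42

/-! ### The complex Grassmannian of 2-planes in `ℂ⁴` -/

/-- The set of 2-dimensional complex subspaces of `ℂ⁴`. -/
def Grassmannian : Type :=
  {L : Submodule ℂ (Fin 4 → ℂ) // Module.finrank ℂ L = 2}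

/-- The columns of the `4 × 2` matrix `A` span (equivalently, form a basis of) the plane `L`. -/
def IsFrame (L : Grassmannian) (A : Matrix (Fin 4) (Fin 2) ℂ) : Prop :=
  LinearMap.range A.mulVecLin = L.1

theorem exists_isFrame (L : Grassmannian) : ∃ A, IsFrame L A := by
  have : Module.finrank ℂ L.1 = 2 := L.2
  let b := Module.finBasisOfFinrankEq ℂ L.1 this
  refine ⟨Matrix.of fun i k => (b k : Fin 4 → ℂ) i, ?_⟩
  unfold IsFrame
  rw [Matrix.range_mulVecLin]
  have h1 : (Set.range (Matrix.of fun i k => (b k : Fin 4 → ℂ) i).col)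
      = L.1.subtype '' (Set.range b) := by
    rw [← Set.range_comp]
    rfl
  rw [h1, Submodule.span_image, b.span_eq, Submodule.map_top, Submodule.range_subtype]

/-- A basis matrix of the plane `L`. -/
def frame (L : Grassmannian) : Matrix (Fin 4) (Fin 2) ℂ := (exists_isFrame L).choose

theorem isFrame_frame (L : Grassmannian) : IsFrame L (frame L) := (exists_isFrame L).choose_spec

theorem IsFrame.injective {L : Grassmannian} {A : Matrix (Fin 4) (Fin 2) ℂ} (h : IsFrame L A) :
    Function.Injective A.mulVec := by
  have h1 := LinearMap.finrank_range_add_finrank_ker A.mulVecLin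
  have h2 : Module.finrank ℂ (LinearMap.range A.mulVecLin) = 2 := by
    rw [show LinearMap.range A.mulVecLin = L.1 from h]; exact L.2
  have h3 : Module.finrank ℂ (LinearMap.ker A.mulVecLin) = 0 := by
    simp only [h2, Module.finrank_fintype_fun_eq_card, Fintype.card_fin] at h1
    omega
  have h4 := Submodule.finrank_eq_zero.mp h3
  exact LinearMap.ker_eq_bot.mp h4

/-- The plane spanned by the columns of a `4 × 2` matrix with linearly independent columns. -/
def ofFrame (A : Matrix (Fin 4) (Fin 2) ℂ) (h : Function.Injective A.mulVec) : Grassmannian :=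
  ⟨LinearMap.range A.mulVecLin, by
    rw [LinearMap.finrank_range_of_inj (f := A.mulVecLin) h]
    simp⟩

theorem IsFrame.exists_mul {L : Grassmannian} {A B : Matrix (Fin 4) (Fin 2) ℂ}
    (hA : IsFrame L A) (hB : IsFrame L B) : ∃ G : Matrix (Fin 2) (Fin 2) ℂ, A = B * G := by
  have h : ∀ k, ∃ c, B.mulVecLin c = A.col k := by
    intro k
    have h1 : A.col k ∈ LinearMap.range A.mulVecLin := by
      rw [Matrix.range_mulVecLin]
      exact Submodule.subset_span ⟨k, rfl⟩
    rw [show LinearMap.range A.mulVecLin = LinearMap.range B.mulVecLin from hA.trans hB.symm] at h1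
    exact h1
  choose c hc using h
  refine ⟨Matrix.of fun i k => c k i, ?_⟩
  ext i k
  have := congrFun (hc k) i
  simp only [Matrix.mulVecLin_apply, Matrix.mulVec, dotProduct, Matrix.col_apply] at this
  simp only [Matrix.mul_apply, Matrix.of_apply]
  exact this.symm

theorem IsFrame.det_ne_zero {L : Grassmannian} {A B : Matrix (Fin 4) (Fin 2) ℂ}
    {G : Matrix (Fin 2) (Fin 2) ℂ} (hA : IsFrame L A) (hG : A = B * G) : G.det ≠ 0 := by
  intro h0
  obtain ⟨v, hv, hv0⟩ := Matrix.exists_mulVec_eq_zero_iff.mpr h0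
  apply hv
  apply hA.injective
  rw [hG, ← Matrix.mulVec_mulVec, hv0]
  simp

/-! ### Plücker coordinates and the moment map -/

/-- The pairs `{i, j}` with `i < j`. -/
abbrev Pair : Type := {p : Fin 4 × Fin 4 // p.1 < p.2}

/-- The `2 × 2` minor of `A` on the rows `i < j`. -/
def minor (A : Matrix (Fin 4) (Fin 2) ℂ) (I : Pair) : ℂ :=
  A I.1.1 0 * A I.1.2 1 - A I.1.1 1 * A I.1.2 0

/-- The Plücker coordinate of `L`, for the chosen basis of `L` (so it is defined up to a common
nonzero factor, see `plucker_eq`). -/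
def plucker (L : Grassmannian) (I : Pair) : ℂ := minor (frame L) I

/-- The weight vector `Λ_{ij} = e_i + e_j`. -/
def weight (I : Pair) : Fin 4 → ℝ := fun k => if k = I.1.1 ∨ k = I.1.2 then 1 else 0

/-- The moment map `μ(L) = (∑ |P^I(L)|²)⁻¹ ∑ |P^I(L)|² Λ_I`. -/
def momentMap (L : Grassmannian) : Fin 4 → ℝ :=
  (∑ I, ‖plucker L I‖ ^ 2)⁻¹ • ∑ I, ‖plucker L I‖ ^ 2 • weight I

theorem plucker_eq {L : Grassmannian} {A : Matrix (Fin 4) (Fin 2) ℂ} (hA : IsFrame L A) :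
    ∃ c : ℂ, c ≠ 0 ∧ ∀ I, minor A I = c * plucker L I := by
  obtain ⟨G, hG⟩ := hA.exists_mul (isFrame_frame L)
  refine ⟨G.det, hA.det_ne_zero hG, fun I => ?_⟩
  simp only [minor, plucker, hG, Matrix.mul_apply, Fin.sum_univ_two, Matrix.det_fin_two]
  ring

/-- The moment map may be computed with any basis of `L`. -/
theorem momentMap_eq {L : Grassmannian} {A : Matrix (Fin 4) (Fin 2) ℂ} (hA : IsFrame L A) :
    momentMap L = (∑ I, ‖minor A I‖ ^ 2)⁻¹ • ∑ I, ‖minor A I‖ ^ 2 • weight I := by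
  obtain ⟨c, hc, h⟩ := plucker_eq hA
  have hc' : ‖c‖ ^ 2 ≠ 0 := by simpa using hc
  simp only [h, norm_mul, mul_pow, momentMap, ← Finset.mul_sum, mul_smul, ← Finset.smul_sum,
    mul_inv]
  rw [smul_comm (‖c‖ ^ 2)⁻¹, smul_smul (‖c‖ ^ 2)⁻¹, inv_mul_cancel₀ hc', one_smul]

/-! ### Strata, admissible polytopes, chambers -/

/-- The stratum `W_σ`. -/
def stratum (σ : Set Pair) : Set Grassmannian := {L | ∀ I, plucker L I ≠ 0 ↔ I ∈ σ}

/-- `σ` indexes a (non-empty) stratum, i.e. `polytope σ` is an admissible polytope. -/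
def IsAdmissible (σ : Set Pair) : Prop := (stratum σ).Nonempty

/-- `P_σ`, the convex hull of the `Λ_I`, `I ∈ σ`. -/
def polytope (σ : Set Pair) : Set (Fin 4 → ℝ) := convexHull ℝ (weight '' σ)

/-- `C` is a chamber: a non-empty intersection of the relative interiors of the admissible
polytopes `P_σ`, `σ ∈ w`, that does not meet the relative interior of any other admissible
polytope. -/
def IsChamber (C : Set (Fin 4 → ℝ)) : Prop :=
  C.Nonempty ∧ ∃ w : Set (Set Pair), (∀ σ ∈ w, IsAdmissible σ) ∧
    C = ⋂ σ ∈ w, intrinsicInterior ℝ (polytope σ) ∧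
    ∀ σ, IsAdmissible σ → σ ∉ w → Disjoint C (intrinsicInterior ℝ (polytope σ))

/-- A chamber of maximal dimension, that is of dimension `3`. -/
def IsMaximalChamber (C : Set (Fin 4 → ℝ)) : Prop :=
  IsChamber C ∧ Module.finrank ℝ (vectorSpan ℝ C) = 3

/-! ### The smooth structure of the Grassmannian -/

/-- A choice of two of the four coordinates (`inl`) and of the complementary two (`inr`). -/
abbrev Split : Type := Fin 4 ≃ Fin 2 ⊕ Fin 2

/-- The model space `ℂ^{2 × 2}`. -/
abbrev Model : Type := Fin 2 → Fin 2 → ℂ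

/-- The two chosen rows of `A`. -/
def rowsL (p : Split) (A : Matrix (Fin 4) (Fin 2) ℂ) : Matrix (Fin 2) (Fin 2) ℂ :=
  A.submatrix (fun a => p.symm (Sum.inl a)) id

/-- The two complementary rows of `A`. -/
def rowsR (p : Split) (A : Matrix (Fin 4) (Fin 2) ℂ) : Matrix (Fin 2) (Fin 2) ℂ :=
  A.submatrix (fun a => p.symm (Sum.inr a)) id

/-- The `4 × 2` matrix whose chosen rows form the identity matrix and whose complementary rows
form `X`. -/
def graphFrame (p : Split) (X : Model) : Matrix (Fin 4) (Fin 2) ℂ :=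
  Matrix.of fun i k => Sum.elim (fun a => (1 : Matrix (Fin 2) (Fin 2) ℂ) a k) (fun b => X b k) (p i)

@[simp] theorem rowsL_graphFrame (p : Split) (X : Model) : rowsL p (graphFrame p X) = 1 := by
  ext i k; simp [rowsL, graphFrame]

@[simp] theorem rowsR_graphFrame (p : Split) (X : Model) :
    rowsR p (graphFrame p X) = Matrix.of X := by
  ext i k; simp [rowsR, graphFrame]

theorem rowsL_mul (p : Split) (A : Matrix (Fin 4) (Fin 2) ℂ) (G : Matrix (Fin 2) (Fin 2) ℂ) :
    rowsL p (A * G) = rowsL p A * G := by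
  ext i k; simp [rowsL, Matrix.mul_apply]

theorem rowsR_mul (p : Split) (A : Matrix (Fin 4) (Fin 2) ℂ) (G : Matrix (Fin 2) (Fin 2) ℂ) :
    rowsR p (A * G) = rowsR p A * G := by
  ext i k; simp [rowsR, Matrix.mul_apply]

theorem ext_rows (p : Split) {A B : Matrix (Fin 4) (Fin 2) ℂ} (hL : rowsL p A = rowsL p B)
    (hR : rowsR p A = rowsR p B) : A = B := by
  ext i k
  obtain ⟨s, rfl⟩ := p.symm.surjective i
  rcases s with a | b
  · exact congrFun (congrFun hL a) k
  · exact congrFun (congrFun hR b) k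

theorem injective_mulVec_of_rowsL (p : Split) {A : Matrix (Fin 4) (Fin 2) ℂ}
    (h : (rowsL p A).det ≠ 0) : Function.Injective A.mulVec := by
  have h1 : Function.Injective (rowsL p A).mulVec :=
    Matrix.mulVec_injective_of_isUnit ((Matrix.isUnit_iff_isUnit_det _).mpr h.isUnit)
  intro v w hvw
  apply h1
  ext a
  exact congrFun hvw (p.symm (Sum.inl a))

/-- The plane which is the graph of `X : ℂ² → ℂ²` with respect to the splitting `p`. -/
def graphPlane (p : Split) (X : Model) : Grassmannian :=
  ofFrame (graphFrame p X) (injective_mulVec_of_rowsL p (by simp))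

/-- The affine coordinates of a plane with respect to the splitting `p`. -/
def affineCoord (p : Split) (A : Matrix (Fin 4) (Fin 2) ℂ) : Model :=
  fun i k => (rowsR p A * (rowsL p A)⁻¹) i k

theorem affineCoord_eq {L : Grassmannian} {A B : Matrix (Fin 4) (Fin 2) ℂ} (hA : IsFrame L A)
    (hB : IsFrame L B) (p : Split) : affineCoord p A = affineCoord p B := by
  obtain ⟨G, hG⟩ := hA.exists_mul hB
  have h := (hA.det_ne_zero hG).isUnit
  ext i k
  simp only [affineCoord, hG, rowsR_mul, rowsL_mul, Matrix.mul_inv_rev]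
  rw [Matrix.mul_assoc, ← Matrix.mul_assoc G, Matrix.mul_nonsing_inv G h, Matrix.one_mul]

theorem det_rowsL_ne_zero_iff {L : Grassmannian} {A B : Matrix (Fin 4) (Fin 2) ℂ}
    (hA : IsFrame L A) (hB : IsFrame L B) (p : Split) :
    (rowsL p A).det ≠ 0 ↔ (rowsL p B).det ≠ 0 := by
  obtain ⟨G, hG⟩ := hA.exists_mul hB
  have h := hA.det_ne_zero hG
  rw [hG, rowsL_mul, Matrix.det_mul]
  simp [h]

theorem isFrame_graphPlane (p : Split) (X : Model) : IsFrame (graphPlane p X) (graphFrame p X) :=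
  rfl

theorem graphPlane_affineCoord {L : Grassmannian} {A : Matrix (Fin 4) (Fin 2) ℂ}
    (hA : IsFrame L A) (p : Split) (h : (rowsL p A).det ≠ 0) :
    graphPlane p (affineCoord p A) = L := by
  have hu := h.isUnit
  have e : A = graphFrame p (affineCoord p A) * rowsL p A := by
    apply ext_rows p
    · simp [rowsL_mul]
    · rw [rowsR_mul, rowsR_graphFrame]
      change _ = rowsR p A * (rowsL p A)⁻¹ * rowsL p A
      rw [Matrix.mul_assoc, Matrix.nonsing_inv_mul _ hu, Matrix.mul_one]
  apply Subtype.ext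
  rw [← show _ = L.1 from hA]
  change LinearMap.range (graphFrame p (affineCoord p A)).mulVecLin = _
  conv_rhs => rw [e, Matrix.mulVecLin_mul]
  rw [LinearMap.range_comp_of_range_eq_top]
  rw [LinearMap.range_eq_top]
  exact Matrix.mulVec_surjective_iff_isUnit.mpr ((Matrix.isUnit_iff_isUnit_det _).mpr hu)

/-- The standard affine chart on the planes whose Plücker coordinate on the two chosen
coordinates is nonzero. -/
def affineChart (p : Split) : PartialEquiv Grassmannian Model where
  toFun L := affineCoord p (frame L)
  invFun X := graphPlane p X
  source := {L | (rowsL p (frame L)).det ≠ 0}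
  target := Set.univ
  map_source' _ _ := Set.mem_univ _
  map_target' X _ := by
    rw [Set.mem_ofPred_eq, det_rowsL_ne_zero_iff (isFrame_frame _) (isFrame_graphPlane p X)]
    simp
  left_inv' L h := graphPlane_affineCoord (isFrame_frame L) p h
  right_inv' X _ := by
    rw [affineCoord_eq (isFrame_frame _) (isFrame_graphPlane p X)]
    ext i k
    simp [affineCoord]

theorem exists_mem_affineChart_source (L : Grassmannian) : ∃ p, L ∈ (affineChart p).source := by
  have hinj := (isFrame_frame L).injective
  set A := frame L with hAdef
  have key : ∃ i j, A i 0 * A j 1 - A i 1 * A j 0 ≠ 0 := by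
    by_contra! hcon
    by_cases h0 : ∀ i, A i 0 = 0
    · have : A.mulVec ![1, 0] = A.mulVec 0 := by
        ext i; simp [Matrix.mulVec, dotProduct, Fin.sum_univ_two, h0]
      have := congrFun (hinj this) 0
      simp at this
    · push Not at h0
      obtain ⟨i, hi⟩ := h0
      have : A.mulVec ![A i 1, -A i 0] = A.mulVec 0 := by
        ext j
        have := hcon i j
        simp only [Matrix.mulVec, dotProduct, Fin.sum_univ_two, Matrix.cons_val_zero,
          Matrix.cons_val_one, Pi.zero_apply, mul_zero, add_zero]
        linear_combination -this
      have := congrFun (hinj this) 1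
      simp at this
      exact hi this
  obtain ⟨i, j, hij⟩ := key
  have hne : i ≠ j := by
    rintro rfl
    apply hij
    ring
  have hperm : ∀ i j : Fin 4, i ≠ j → ∃ s : Equiv.Perm (Fin 4), s 0 = i ∧ s 1 = j := by decide
  obtain ⟨s, hs0, hs1⟩ := hperm i j hne
  refine ⟨s.symm.trans (finSumFinEquiv (m := 2) (n := 2)).symm, ?_⟩
  change (rowsL _ A).det ≠ 0
  rw [Matrix.det_fin_two]
  have e0 : finSumFinEquiv (m := 2) (n := 2) (Sum.inl 0) = 0 := rfl
  have e1 : finSumFinEquiv (m := 2) (n := 2) (Sum.inl 1) = 1 := rfl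
  simpa [rowsL, e0, e1, hs0, hs1] using hij

theorem affineChart_symm_trans_source (p q : Split) :
    ((affineChart p).symm.trans (affineChart q)).source =
      {X | (rowsL q (graphFrame p X)).det ≠ 0} := by
  ext X
  simp only [PartialEquiv.trans_source, Set.mem_inter_iff, Set.mem_preimage, Set.mem_ofPred_eq]
  rw [← det_rowsL_ne_zero_iff (isFrame_frame (graphPlane p X)) (isFrame_graphPlane p X)]
  exact ⟨fun h => h.2, fun h => ⟨Set.mem_univ _, h⟩⟩

theorem affineChart_symm_trans_apply (p q : Split) (X : Model) :
    (affineChart p).symm.trans (affineChart q) X = affineCoord q (graphFrame p X) :=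
  affineCoord_eq (isFrame_frame _) (isFrame_graphPlane p X) q

theorem contDiff_graphFrame (p : Split) (i : Fin 4) (k : Fin 2) :
    ContDiff ℝ ∞ (fun X : Model => graphFrame p X i k) := by
  unfold graphFrame
  simp only [Matrix.of_apply]
  rcases p i with a | b
  · exact contDiff_const
  · simp only [Sum.elim_inr]
    fun_prop

theorem contDiff_det (p q : Split) :
    ContDiff ℝ ∞ (fun X : Model => (rowsL q (graphFrame p X)).det) := by
  simp only [Matrix.det_fin_two, rowsL, Matrix.submatrix_apply, id]
  have := contDiff_graphFrame p
  exact ((this _ _).mul (this _ _)).sub ((this _ _).mul (this _ _))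

/-- The coordinate changes between affine charts are smooth. -/
theorem contDiffOn_transition (p q : Split) :
    ContDiffOn ℝ ∞ (fun X : Model => affineCoord q (graphFrame p X))
      {X | (rowsL q (graphFrame p X)).det ≠ 0} := by
  have h := contDiff_graphFrame p
  rw [contDiffOn_pi]
  intro i
  rw [contDiffOn_pi]
  intro k
  have hd := (contDiff_det p q).contDiffOn.inv
    (s := {X | (rowsL q (graphFrame p X)).det ≠ 0}) (fun X hX => hX)
  have hr : ∀ j l, ContDiff ℝ ∞ fun X : Model => rowsR q (graphFrame p X) j l :=
    fun j l => h _ _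
  have hl : ∀ j l, ContDiff ℝ ∞ fun X : Model => rowsL q (graphFrame p X) j l :=
    fun j l => h _ _
  have ha : ∀ j l, ContDiff ℝ ∞ fun X : Model => (rowsL q (graphFrame p X)).adjugate j l := by
    intro j l
    simp only [Matrix.adjugate_fin_two]
    fin_cases j <;> fin_cases l
    · exact hl 1 1
    · exact (hl 0 1).neg
    · exact (hl 1 0).neg
    · exact hl 0 0
  simp only [affineCoord, Matrix.inv_def, Ring.inverse_eq_inv', Matrix.mul_apply,
    Fin.sum_univ_two, Matrix.smul_apply, smul_eq_mul]
  exact ((hr _ _).contDiffOn.mul (hd.mul (ha _ _).contDiffOn)).add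
    ((hr _ _).contDiffOn.mul (hd.mul (ha _ _).contDiffOn))

/-- The atlas of affine charts. -/
def chartCore : ChartedSpaceCore Model Grassmannian where
  atlas := Set.range affineChart
  chartAt L := affineChart (exists_mem_affineChart_source L).choose
  mem_chart_source L := (exists_mem_affineChart_source L).choose_spec
  chart_mem_atlas _ := ⟨_, rfl⟩
  open_source := by
    rintro _ _ ⟨p, rfl⟩ ⟨q, rfl⟩
    rw [affineChart_symm_trans_source]
    exact isOpen_ne_fun (contDiff_det p q).continuous continuous_const
  continuousOn_toFun := by
    rintro _ _ ⟨p, rfl⟩ ⟨q, rfl⟩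
    rw [affineChart_symm_trans_source]
    exact (contDiffOn_transition p q).continuousOn.congr
      fun X _ => affineChart_symm_trans_apply p q X

instance : TopologicalSpace Grassmannian := chartCore.toTopologicalSpace

instance : ChartedSpace Model Grassmannian := chartCore.toChartedSpace

/-- The Grassmannian is a smooth (real) manifold. -/
instance : IsManifold 𝓘(ℝ, Model) ∞ Grassmannian := by
  apply isManifold_of_contDiffOn
  rintro e e' he he'
  obtain ⟨e0, h0⟩ := Set.mem_iUnion.mp he
  obtain ⟨⟨p, rfl⟩, h0⟩ := Set.mem_iUnion.mp h0
  obtain rfl := Set.mem_singleton_iff.mp h0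
  obtain ⟨e1, h1⟩ := Set.mem_iUnion.mp he'
  obtain ⟨⟨q, rfl⟩, h1⟩ := Set.mem_iUnion.mp h1
  obtain rfl := Set.mem_singleton_iff.mp h1
  have hs := affineChart_symm_trans_source p q
  have := contDiffOn_transition p q
  rw [← hs] at this
  simp only [modelWithCornersSelf_coe, modelWithCornersSelf_coe_symm, Set.range_id,
    Set.inter_univ, Set.preimage_id, Function.id_comp, Function.comp_id]
  exact this.congr fun X _ => affineChart_symm_trans_apply p q X

/-! ### Level sets of the moment map as submanifolds -/

/-- The level set `μ⁻¹(x)`, with the subspace topology. -/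
abbrev levelSet (x : Fin 4 → ℝ) : Set Grassmannian := momentMap ⁻¹' {x}

/-- The atlas `c` on `S` is the one of an embedded smooth submanifold of the Grassmannian, of real
dimension `d`. (There is at most one such smooth structure on `S`.) -/
def IsSubmanifoldAtlas (d : ℕ) (S : Set Grassmannian)
    (c : ChartedSpace (EuclideanSpace ℝ (Fin d)) S) : Prop :=
  IsManifold (𝓡 d) ∞ S ∧
    Manifold.IsSmoothEmbedding (𝓡 d) 𝓘(ℝ, Model) ∞ (Subtype.val : S → Grassmannian)

end Gr42

end

/-! Fibres over one chamber are compared by the positive diagonal group, fibres over different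
chambers by symmetries of the hypersimplex.

Same chamber. The diagonal matrix with entries exp(t_i/2) multiplies |P^I|² by exp⟨t, Λ_I⟩, and μ(L)
= y says Σ |P^I|² (Λ_I − y) = 0. Moving L into μ⁻¹(y) along its orbit therefore means finding a
critical point of the convex function t ↦ Σ |P^I|² exp⟨t, Λ_I − y⟩, as in the Kempf–Ness argument;
an added term ⟨t, 1⟩²/2 removes the direction in which this function is constant. If y is interior
to the polytope of L, a critical point exists (`exists_gradient_eq_zero`), is unique
(`gradient_injective`) and depends smoothly on L (`contDiffAt_critical_comp`). This gives `flow y`,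
with inverse `flow x` (`flow_flow`). That every plane over x has y interior to its polytope is
checked on one model chamber from the Plücker relation (`stable_of_dominantChamber`).

Different chambers. A point of a maximal chamber lies on none of the walls x_i = 0, x_i = 1, x_i +
x_j = 1, since over a point of a wall there is a plane whose whole polytope lies in the wall
(`IsMaximalChamber.sum_ne_one`, `IsMaximalChamber.pos`). The signs of x_0 + x_j − 1 leave eight
cases, and coordinate permutations together with L ↦ L^⊥, which turns μ into 1 − μ, carry each of
them to the model chamber (`IsMaximalChamber.exists_levelEquiv`). No wall crossing has to be
analysed.

Submanifold. In an affine chart the fibre is the zero set of Σ |P^I|² (Λ_I − x), which takes values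
in a 3-dimensional space. Along the positive diagonal orbit its derivative is the Hessian of the
same convex function, invertible because the polytope of every plane over a maximal chamber is
3-dimensional. Hence it is a submersion at the fibre, and 8 − 3 = 5. All comparison maps are smooth
in the ambient Grassmannian, so they restrict to diffeomorphisms for any embedded structures on the
fibres. -/

section Slice

/-! ### Slice charts and the regular value theorem for subsets of a manifold. -/

open Set Topology Manifold

variable {E E' F : Type*} [NormedAddCommGroup E] [NormedSpace ℝ E]
  [NormedAddCommGroup E'] [NormedSpace ℝ E'] [NormedAddCommGroup F] [NormedSpace ℝ F]
  {M : Type*} [TopologicalSpace M]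

open Classical in
/-- The chart induced on `S` by a slice chart `ψ` of the ambient manifold. -/
noncomputable def sliceChart (e : (E × F) ≃L[ℝ] E') {S : Set M} (s : S)
    (ψ : OpenPartialHomeomorph M E')
    (hψ : ∀ m ∈ ψ.source, m ∈ S ↔ (e.symm (ψ m)).2 = 0) : OpenPartialHomeomorph S E where
  toFun m := (e.symm (ψ m)).1
  -- On the target the condition always holds; the default `s` only makes the inverse total.
  invFun v := if h : ψ.symm (e (v, 0)) ∈ S then ⟨ψ.symm (e (v, 0)), h⟩ else s
  source := Subtype.val ⁻¹' ψ.source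
  target := (fun v => e (v, 0)) ⁻¹' ψ.target
  map_source' m hm := by
    have h2 := (hψ m hm).1 m.2
    have h3 : e ((e.symm (ψ m)).1, 0) = ψ m := by
      rw [← h2]; simp
    simp only [mem_preimage, h3]
    exact ψ.map_source hm
  map_target' v hv := by
    have hS : ψ.symm (e (v, 0)) ∈ S := by
      rw [hψ _ (ψ.map_target hv), ψ.right_inv hv]; simp
    simp only [dif_pos hS, mem_preimage]
    exact ψ.map_target hv
  left_inv' m hm := by
    have h2 := (hψ m hm).1 m.2
    have h3 : e ((e.symm (ψ m)).1, 0) = ψ m := by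
      rw [← h2]; simp
    have h4 : ψ.symm (ψ m) = m := ψ.left_inv hm
    apply Subtype.ext
    simp only [h3, h4]
    rw [dif_pos m.2]
  right_inv' v hv := by
    have hS : ψ.symm (e (v, 0)) ∈ S := by
      rw [hψ _ (ψ.map_target hv), ψ.right_inv hv]; simp
    simp only [dif_pos hS, ψ.right_inv hv]
    simp
  open_source := ψ.open_source.preimage continuous_subtype_val
  open_target := ψ.open_target.preimage (by fun_prop)
  continuousOn_toFun := by
    have h1 : ContinuousOn (fun m : S => ψ m) (Subtype.val ⁻¹' ψ.source) :=
      ψ.continuousOn.comp continuous_subtype_val.continuousOn fun _ h => h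
    exact (continuous_fst.comp e.symm.continuous).comp_continuousOn h1
  continuousOn_invFun := by
    rw [IsInducing.subtypeVal.continuousOn_iff]
    have h1 : ContinuousOn (fun v : E => ψ.symm (e (v, 0)))
        ((fun v => e (v, 0)) ⁻¹' ψ.target) :=
      ψ.continuousOn_symm.comp (by fun_prop) fun _ h => h
    refine h1.congr fun v hv => ?_
    have hS : ψ.symm (e (v, 0)) ∈ S := by
      rw [hψ _ (ψ.map_target hv), ψ.right_inv hv]; simp
    simp only [Function.comp, dif_pos hS]

theorem coe_sliceChart_symm (e : (E × F) ≃L[ℝ] E') {S : Set M} (s : S)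
    (ψ : OpenPartialHomeomorph M E')
    (hψ : ∀ m ∈ ψ.source, m ∈ S ↔ (e.symm (ψ m)).2 = 0) {v : E}
    (hv : e (v, 0) ∈ ψ.target) :
    ((sliceChart e s ψ hψ).symm v : M) = ψ.symm (e (v, 0)) := by
  have hS : ψ.symm (e (v, 0)) ∈ S := by
    rw [hψ _ (ψ.map_target hv), ψ.right_inv hv]; simp
  exact congrArg Subtype.val (dif_pos hS)

/-- A subset which is locally a slice in suitable charts is an embedded submanifold. -/
theorem exists_isSmoothEmbedding_of_slices [ChartedSpace E' M] [IsManifold 𝓘(ℝ, E') ∞ M]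
    (e : (E × F) ≃L[ℝ] E') {S : Set M}
    (h : ∀ s ∈ S, ∃ ψ ∈ IsManifold.maximalAtlas 𝓘(ℝ, E') ∞ M, s ∈ ψ.source ∧
      ∀ m ∈ ψ.source, m ∈ S ↔ (e.symm (ψ m)).2 = 0) :
    ∃ _c : ChartedSpace E S, IsManifold 𝓘(ℝ, E) ∞ S ∧
      Manifold.IsSmoothEmbedding 𝓘(ℝ, E) 𝓘(ℝ, E') ∞ (Subtype.val : S → M) := by
  choose ψ hmax hmem hS using fun s : S => h s s.2
  let ch : S → OpenPartialHomeomorph S E := fun s => sliceChart e s (ψ s) (hS s)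
  let c : ChartedSpace E S :=
    { atlas := range ch
      chartAt := ch
      mem_chart_source := fun s => hmem s
      chart_mem_atlas := fun s => ⟨s, rfl⟩ }
  have hman : IsManifold 𝓘(ℝ, E) ∞ S := by
    apply isManifold_of_contDiffOn
    rintro _ _ ⟨s, rfl⟩ ⟨s', rfl⟩
    simp only [modelWithCornersSelf_coe, modelWithCornersSelf_coe_symm, Set.range_id,
      Set.inter_univ, Set.preimage_id, Function.id_comp, Function.comp_id]
    -- A transition between slice charts is the ambient transition restricted to `E × 0` and
    -- projected back to `E`.
    have h1 : ContDiffOn ℝ ∞ (ψ s' ∘ (ψ s).symm) ((ψ s).symm ≫ₕ ψ s').source := by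
      have := ((contMDiffOn_of_mem_maximalAtlas (hmax s')).comp'
        (contMDiffOn_symm_of_mem_maximalAtlas (hmax s)))
      rw [contMDiffOn_iff_contDiffOn] at this
      exact this.mono (by intro z hz; simpa using hz)
    have h2 : ContDiffOn ℝ ∞ (fun v : E => (e.symm (ψ s' ((ψ s).symm (e (v, 0))))).1)
        ((fun v => e (v, 0)) ⁻¹' ((ψ s).symm ≫ₕ ψ s').source) := by
      have h3 : ContDiff ℝ ∞ (fun v : E => e (v, (0 : F))) :=
        e.contDiff.comp (contDiff_id.prodMk contDiff_const)
      exact (contDiff_fst.comp e.symm.contDiff).comp_contDiffOn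
        (h1.comp h3.contDiffOn fun _ h => h)
    refine (h2.mono ?_).congr ?_
    · intro v hv
      rw [OpenPartialHomeomorph.trans_source] at hv
      have hv1 : e (v, 0) ∈ (ψ s).target := hv.1
      have hv2 : ((ch s).symm v : M) ∈ (ψ s').source := hv.2
      rw [coe_sliceChart_symm e s _ _ hv1] at hv2
      simpa using ⟨hv1, hv2⟩
    · intro v hv
      rw [OpenPartialHomeomorph.trans_source] at hv
      have hv1 : e (v, 0) ∈ (ψ s).target := hv.1
      change (e.symm (ψ s' ((ch s).symm v : M))).1 = _
      rw [coe_sliceChart_symm e s _ _ hv1]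
  refine ⟨c, hman, ?_, IsEmbedding.subtypeVal⟩
  -- Read in `ch s` and `ψ s`, the inclusion is exactly `v ↦ e (v, 0)`, the normal form of an
  -- immersion.
  have him : IsImmersionOfComplement F 𝓘(ℝ, E) 𝓘(ℝ, E') ∞ (Subtype.val : S → M) := by
    intro s
    refine IsImmersionAtOfComplement.mk_of_charts e (ch s) (ψ s) (hmem s) (hmem s)
      (IsManifold.subset_maximalAtlas ⟨s, rfl⟩) (hmax s) (fun _ h => h) ?_
    intro v hv
    have hv1 : e (v, 0) ∈ (ψ s).target := by
      have : v ∈ (ch s).target := by simpa using hv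
      exact this
    change ψ s ((ch s).symm v : M) = e (v, 0)
    rw [coe_sliceChart_symm e s _ _ hv1, (ψ s).right_inv hv1]
  exact him.isImmersion

/-- A smooth map with surjective derivative is part of a local smooth coordinate system. -/
theorem exists_straightening [FiniteDimensional ℝ E] [FiniteDimensional ℝ E']
    [FiniteDimensional ℝ F] (e : (E × F) ≃L[ℝ] E')
    {f : E' → F} (hf : ContDiff ℝ ∞ f) {a : E'} {f' : E' →L[ℝ] F} (hfa : HasFDerivAt f f' a)
    (hsurj : Function.Surjective f') :
    ∃ g : OpenPartialHomeomorph E' E', a ∈ g.source ∧ ContDiffOn ℝ ∞ g g.source ∧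
      ContDiffOn ℝ ∞ g.symm g.target ∧ ∀ z, (e.symm (g z)).2 = f z := by
  have hk : Module.finrank ℝ (LinearMap.ker f'.toLinearMap) = Module.finrank ℝ E := by
    have h1 := f'.toLinearMap.finrank_range_add_finrank_ker
    rw [LinearMap.range_eq_top.2 hsurj, finrank_top] at h1
    have h2 := e.toLinearEquiv.finrank_eq
    rw [Module.finrank_prod] at h2
    omega
  -- Extend an isomorphism `ker f' ≃ E` to a map `P` on `E'`. Then `(P, f')` is injective, hence
  -- bijective by dimension, and `z ↦ e (Q z, f z)` is a local diffeomorphism at `a` with second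
  -- component `f`.
  let k : LinearMap.ker f'.toLinearMap ≃ₗ[ℝ] E := LinearEquiv.ofFinrankEq _ _ hk
  obtain ⟨P, hP⟩ := LinearMap.exists_extend k.toLinearMap
  let Q : E' →L[ℝ] E := P.toContinuousLinearMap
  have hinj : Function.Injective (P.prod f'.toLinearMap) := by
    rw [← LinearMap.ker_eq_bot, LinearMap.ker_eq_bot']
    intro v hv
    have h1 : P v = 0 := congrArg Prod.fst hv
    have h2 : f' v = 0 := congrArg Prod.snd hv
    have h3 : k ⟨v, h2⟩ = P v := by
      rw [show P v = (P ∘ₗ (LinearMap.ker f'.toLinearMap).subtype) ⟨v, h2⟩ from rfl, hP]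
      rfl
    rw [h1, k.map_eq_zero_iff] at h3
    exact congrArg Subtype.val h3
  let ℓ : E' ≃ₗ[ℝ] E × F := LinearEquiv.ofInjectiveOfFinrankEq (P.prod f'.toLinearMap) hinj
    e.toLinearEquiv.finrank_eq.symm
  let T : E' ≃L[ℝ] E' := ℓ.toContinuousLinearEquiv.trans e
  let G : E' → E' := fun z => e (Q z, f z)
  have hG : ContDiff ℝ ∞ G := e.contDiff.comp (Q.contDiff.prodMk hf)
  have hGa : HasFDerivAt G (T : E' →L[ℝ] E') a := by
    have := e.toContinuousLinearMap.hasFDerivAt.comp a ((Q.hasFDerivAt (x := a)).prodMk hfa)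
    convert! this using 1
  let g0 := hG.contDiffAt.toOpenPartialHomeomorph G hGa (by simp)
  have hcont : Continuous (fderiv ℝ G) := hG.continuous_fderiv (by simp)
  -- Smoothness of the inverse on the whole target needs an invertible derivative at every source
  -- point, not only at `a`; the source is cut down to the open set where this holds.
  let U : Set E' := fderiv ℝ G ⁻¹' range ((↑) : (E' ≃L[ℝ] E') → E' →L[ℝ] E')
  have hU : IsOpen U := ContinuousLinearEquiv.isOpen.preimage hcont
  have haU : a ∈ U := ⟨T, hGa.fderiv.symm⟩
  refine ⟨g0.restrOpen U hU, ⟨hG.contDiffAt.mem_toOpenPartialHomeomorph_source hGa (by simp), haU⟩,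
    hG.contDiffOn, ?_, ?_⟩
  · intro w hw
    apply ContDiffAt.contDiffWithinAt
    obtain ⟨T', hT'⟩ := ((g0.restrOpen U hU).map_target hw).2
    refine (g0.restrOpen U hU).contDiffAt_symm hw (f₀' := T') ?_ hG.contDiffAt
    rw [hT']
    exact (hG.differentiable (by simp) _).hasFDerivAt
  · intro z
    change (e.symm (e (Q z, f z))).2 = f z
    simp

/-- A subset locally cut out by a submersion onto a vector space is an embedded submanifold. -/
theorem exists_isSmoothEmbedding_of_submersion [ChartedSpace E' M] [IsManifold 𝓘(ℝ, E') ∞ M]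
    [FiniteDimensional ℝ E] [FiniteDimensional ℝ E'] [FiniteDimensional ℝ F]
    (hdim : Module.finrank ℝ E + Module.finrank ℝ F = Module.finrank ℝ E') {S : Set M}
    (h : ∀ s ∈ S, ∃ ψ ∈ IsManifold.maximalAtlas 𝓘(ℝ, E') ∞ M, s ∈ ψ.source ∧
      ∃ f : E' → F, ContDiff ℝ ∞ f ∧ Function.Surjective (fderiv ℝ f (ψ s)) ∧
        ∀ m ∈ ψ.source, m ∈ S ↔ f (ψ m) = 0) :
    ∃ _c : ChartedSpace E S, IsManifold 𝓘(ℝ, E) ∞ S ∧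
      Manifold.IsSmoothEmbedding 𝓘(ℝ, E) 𝓘(ℝ, E') ∞ (Subtype.val : S → M) := by
  let e : (E × F) ≃L[ℝ] E' := ContinuousLinearEquiv.ofFinrankEq (by
    rw [Module.finrank_prod, hdim])
  refine exists_isSmoothEmbedding_of_slices e fun s hs => ?_
  obtain ⟨ψ, hψ, hsψ, f, hf, hsurj, hfS⟩ := h s hs
  obtain ⟨g, hag, hg, hg', hgf⟩ := exists_straightening e hf
    (hf.differentiable (by simp) (ψ s)).hasFDerivAt hsurj
  refine ⟨ψ ≫ₕ g, ?_, ?_, ?_⟩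
  · apply OpenPartialHomeomorph.mem_maximalAtlas_of_contMDiffOn
    · rw [OpenPartialHomeomorph.coe_trans, OpenPartialHomeomorph.trans_source]
      exact (contMDiffOn_iff_contDiffOn.2 hg).comp' (contMDiffOn_of_mem_maximalAtlas hψ)
    · rw [OpenPartialHomeomorph.coe_trans_symm, OpenPartialHomeomorph.trans_target]
      exact (contMDiffOn_symm_of_mem_maximalAtlas hψ).comp'
        (contMDiffOn_iff_contDiffOn.2 hg')
  · simpa using ⟨hsψ, hag⟩
  · intro m hm
    rw [OpenPartialHomeomorph.trans_source] at hm
    rw [hfS m hm.1, OpenPartialHomeomorph.coe_trans, Function.comp, hgf]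

end Slice

/-! ### Minimising sums of exponentials of linear forms. -/

namespace ExpSum

open Set Topology Filter

variable {ι κ : Type*} [Fintype κ]

/-- The vectors `vᵢ`, `i` in the support of `p`, span a complement of `u`. -/
def Spanning (v : ι → κ → ℝ) (u : κ → ℝ) (p : ι → ℝ) : Prop :=
  ∀ t, t ⬝ᵥ u = 0 → (∀ i, p i ≠ 0 → t ⬝ᵥ v i = 0) → t = 0

/-- The vectors `vᵢ`, `i` in the support of `p`, positively span a complement of `u`. -/
def PosSpanning (v : ι → κ → ℝ) (u : κ → ℝ) (p : ι → ℝ) : Prop :=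
  ∀ t, t ⬝ᵥ u = 0 → (∀ i, p i ≠ 0 → t ⬝ᵥ v i ≤ 0) → t = 0

variable {v : ι → κ → ℝ} {u : κ → ℝ} {p : ι → ℝ}

theorem PosSpanning.spanning (h : PosSpanning v u p) : Spanning v u p :=
  fun t h1 h2 => h t h1 fun i hi => (h2 i hi).le

variable [Fintype ι]

/-- The gradient of the convex function `t ↦ ∑ pᵢ exp ⟨t, vᵢ⟩ + ⟨t, u⟩² / 2`. -/
noncomputable def gradient (v : ι → κ → ℝ) (u : κ → ℝ) (p : ι → ℝ) (t : κ → ℝ) : κ → ℝ :=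
  ∑ i, (p i * Real.exp (t ⬝ᵥ v i)) • v i + (t ⬝ᵥ u) • u

theorem dotProduct_gradient (w t : κ → ℝ) :
    w ⬝ᵥ gradient v u p t =
      ∑ i, p i * Real.exp (t ⬝ᵥ v i) * (w ⬝ᵥ v i) + (t ⬝ᵥ u) * (w ⬝ᵥ u) := by
  simp [gradient, dotProduct_add, dotProduct_sum, dotProduct_smul]

theorem contDiff_dotProduct (w : κ → ℝ) : ContDiff ℝ ∞ (fun t : κ → ℝ => t ⬝ᵥ w) := by
  unfold dotProduct
  fun_prop

theorem continuous_dotProduct_left (w : κ → ℝ) : Continuous (fun t : κ → ℝ => t ⬝ᵥ w) :=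
  (contDiff_dotProduct w).continuous

theorem contDiff_gradient :
    ContDiff ℝ ∞ (fun q : (ι → ℝ) × (κ → ℝ) => gradient v u q.1 q.2) := by
  unfold gradient
  have h (w : κ → ℝ) : ContDiff ℝ ∞ (fun q : (ι → ℝ) × (κ → ℝ) => q.2 ⬝ᵥ w) :=
    (contDiff_dotProduct w).comp contDiff_snd
  refine ContDiff.add (ContDiff.sum fun i _ => ?_) ((h u).smul contDiff_const)
  refine ContDiff.smul (ContDiff.mul ?_ (h _).exp) contDiff_const
  exact (contDiff_apply ℝ ℝ i).comp contDiff_fst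

/-- Uniqueness of the critical point. -/
theorem gradient_injective (hp : ∀ i, 0 ≤ p i) (h : Spanning v u p) :
    Function.Injective (gradient v u p) := by
  intro t t' htt
  have h1 : (t - t') ⬝ᵥ gradient v u p t - (t - t') ⬝ᵥ gradient v u p t' = 0 := by
    rw [htt, sub_self]
  -- Monotonicity of the gradient: its increment paired with `t - t'` is a sum of nonnegative terms,
  -- so each of them vanishes.
  have h2 : ∑ i, p i * ((Real.exp (t ⬝ᵥ v i) - Real.exp (t' ⬝ᵥ v i)) * (t ⬝ᵥ v i - t' ⬝ᵥ v i))
      + ((t - t') ⬝ᵥ u) ^ 2 = 0 := by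
    rw [← h1, dotProduct_gradient, dotProduct_gradient, add_sub_add_comm,
      ← Finset.sum_sub_distrib]
    congr 1
    · refine Finset.sum_congr rfl fun i _ => ?_
      rw [sub_dotProduct]; ring
    · rw [sub_dotProduct]; ring
  have h3 (a b : ℝ) : 0 ≤ (Real.exp a - Real.exp b) * (a - b) := by
    rcases le_total a b with hab | hab
    · exact mul_nonneg_of_nonpos_of_nonpos (sub_nonpos.2 (Real.exp_le_exp.2 hab))
        (sub_nonpos.2 hab)
    · exact mul_nonneg (sub_nonneg.2 (Real.exp_le_exp.2 hab)) (sub_nonneg.2 hab)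
  have h4 : ∀ i ∈ Finset.univ, 0 ≤ p i *
      ((Real.exp (t ⬝ᵥ v i) - Real.exp (t' ⬝ᵥ v i)) * (t ⬝ᵥ v i - t' ⬝ᵥ v i)) :=
    fun i _ => mul_nonneg (hp i) (h3 _ _)
  have h5 := Finset.sum_nonneg h4
  have h6 : ((t - t') ⬝ᵥ u) ^ 2 = 0 := by nlinarith [sq_nonneg ((t - t') ⬝ᵥ u)]
  have h7 := (Finset.sum_eq_zero_iff_of_nonneg h4).1 (by linarith)
  rw [← sub_eq_zero]
  refine h _ (by simpa using h6) fun i hi => ?_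
  have h8 := (mul_eq_zero.1 (h7 i (Finset.mem_univ i))).resolve_left hi
  rw [sub_dotProduct]
  rcases mul_eq_zero.1 h8 with h9 | h9
  · rw [Real.exp_injective (sub_eq_zero.1 h9), sub_self]
  · exact h9

/-- Existence of a critical point. -/
theorem exists_gradient_eq_zero (hp : ∀ i, 0 ≤ p i) (h : PosSpanning v u p) :
    ∃ t, gradient v u p t = 0 := by
  -- `g` is a positively homogeneous lower bound for `f`, up to a constant. Positive spanning makes
  -- it positive off the origin, so compactness of the sphere gives linear growth, `f` is coercive,
  -- and a minimum exists.
  let g : (κ → ℝ) → ℝ := fun t => ∑ i, p i * max (t ⬝ᵥ v i) 0 + |t ⬝ᵥ u|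
  let f : (κ → ℝ) → ℝ := fun t => ∑ i, p i * Real.exp (t ⬝ᵥ v i) + (t ⬝ᵥ u) ^ 2 / 2
  have hgc : Continuous g := by
    have := @continuous_dotProduct_left κ _
    fun_prop
  have hfc : Continuous f := by
    have := @continuous_dotProduct_left κ _
    fun_prop
  have hgpos : ∀ t, t ≠ 0 → 0 < g t := by
    intro t ht
    have h0 : ∀ i ∈ Finset.univ, 0 ≤ p i * max (t ⬝ᵥ v i) 0 :=
      fun i _ => mul_nonneg (hp i) (le_max_right _ _)
    have h1 := Finset.sum_nonneg h0
    have h2 := abs_nonneg (t ⬝ᵥ u)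
    by_contra hcon
    have h3 : ∑ i, p i * max (t ⬝ᵥ v i) 0 = 0 := by
      have : g t = _ := rfl
      linarith
    have h4 : |t ⬝ᵥ u| = 0 := by
      have : g t = _ := rfl
      linarith
    refine ht (h t (abs_eq_zero.1 h4) fun i hi => ?_)
    have h5 := (Finset.sum_eq_zero_iff_of_nonneg h0).1 h3 i (Finset.mem_univ i)
    have h6 := (mul_eq_zero.1 h5).resolve_left hi
    exact (le_max_left _ _).trans h6.le
  have hghom : ∀ (c : ℝ) t, 0 ≤ c → g (c • t) = c * g t := by
    intro c t hc
    simp only [g, smul_dotProduct, smul_eq_mul, abs_mul, abs_of_nonneg hc, mul_add,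
      Finset.mul_sum]
    congr 1
    refine Finset.sum_congr rfl fun i _ => ?_
    rw [← mul_zero c, ← mul_max_of_nonneg _ _ hc, mul_zero]
    ring
  obtain ⟨c, hc, hgc'⟩ : ∃ c > 0, ∀ t, c * ‖t‖ ≤ g t := by
    rcases isEmpty_or_nonempty κ with hκ | hκ
    · exact ⟨1, one_pos, fun t => by
        rw [Subsingleton.elim t 0]
        simp [g]⟩
    obtain ⟨t0, ht0, hmin⟩ := (isCompact_sphere (0 : κ → ℝ) 1).exists_isMinOn
      (NormedSpace.sphere_nonempty.2 zero_le_one) hgc.continuousOn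
    have ht0' : t0 ≠ 0 := ne_zero_of_mem_unit_sphere ⟨t0, ht0⟩
    refine ⟨g t0, hgpos t0 ht0', fun t => ?_⟩
    rcases eq_or_ne t 0 with rfl | ht
    · simp [g]
    have hn : ‖t‖ ≠ 0 := norm_ne_zero_iff.2 ht
    have h1 : g t0 ≤ g (‖t‖⁻¹ • t) := hmin (by simp [norm_smul, hn])
    rw [hghom _ _ (by positivity), ← div_eq_inv_mul, le_div_iff₀ (by positivity)] at h1
    exact h1
  have hfg : ∀ t, g t - 1 / 2 ≤ f t := by
    intro t
    have h1 : ∑ i, p i * max (t ⬝ᵥ v i) 0 ≤ ∑ i, p i * Real.exp (t ⬝ᵥ v i) := by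
      refine Finset.sum_le_sum fun i _ => mul_le_mul_of_nonneg_left (max_le ?_ ?_) (hp i)
      · linarith [Real.add_one_le_exp (t ⬝ᵥ v i)]
      · positivity
    -- This is (|s| − 1)² ≥ 0, the source of the constant 1/2.
    have h2 : |t ⬝ᵥ u| - 1 / 2 ≤ (t ⬝ᵥ u) ^ 2 / 2 := by
      nlinarith [sq_nonneg (|t ⬝ᵥ u| - 1), sq_abs (t ⬝ᵥ u)]
    simp only [g, f]
    linarith
  have hlim : Tendsto f (cocompact (κ → ℝ)) atTop := by
    refine tendsto_atTop_mono (f := fun t => c * ‖t‖ - 1 / 2)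
      (fun t => by linarith [hgc' t, hfg t]) ?_
    exact tendsto_atTop_add_const_right _ _
      ((tendsto_norm_cocompact_atTop (E := κ → ℝ)).const_mul_atTop hc)
  obtain ⟨t, ht⟩ := hfc.exists_forall_le hlim
  refine ⟨t, ?_⟩
  -- Fermat's rule along every line through the minimum `t`.
  have key : ∀ w, w ⬝ᵥ gradient v u p t = 0 := by
    intro w
    have hd : HasDerivAt (fun s : ℝ => f (t + s • w)) (w ⬝ᵥ gradient v u p t) 0 := by
      have hl (z : κ → ℝ) : HasDerivAt (fun s : ℝ => (t + s • w) ⬝ᵥ z) (w ⬝ᵥ z) 0 := by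
        have : (fun s : ℝ => (t + s • w) ⬝ᵥ z) = fun s => t ⬝ᵥ z + s * (w ⬝ᵥ z) := by
          funext s; simp [add_dotProduct]
        rw [this]
        simpa using ((hasDerivAt_id (0 : ℝ)).mul_const (w ⬝ᵥ z)).const_add (t ⬝ᵥ z)
      have h1 : HasDerivAt (fun s : ℝ => ∑ i, p i * Real.exp ((t + s • w) ⬝ᵥ v i))
          (∑ i, p i * (Real.exp ((t + (0 : ℝ) • w) ⬝ᵥ v i) * (w ⬝ᵥ v i))) 0 :=
        HasDerivAt.fun_sum fun i _ => ((hl (v i)).exp).const_mul (p i)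
      have h2 := ((hl u).pow 2).div_const 2
      refine (h1.add h2).congr_deriv ?_
      rw [dotProduct_gradient]
      simp only [zero_smul, add_zero]
      congr 1
      · exact Finset.sum_congr rfl fun i _ => by ring
      · norm_num; ring
    have hm : IsLocalMin (fun s : ℝ => f (t + s • w)) 0 :=
      Filter.Eventually.of_forall fun s => by simpa using ht (t + s • w)
    exact hm.hasDerivAt_eq_zero hd
  have := key (gradient v u p t)
  exact dotProduct_self_eq_zero.1 this

/-- The linear map `w ↦ ∑ qᵢ ⟨w, vᵢ⟩ vᵢ + ⟨w, u⟩ u`. -/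
noncomputable def hessian (v : ι → κ → ℝ) (u : κ → ℝ) (q : ι → ℝ) : (κ → ℝ) →ₗ[ℝ] (κ → ℝ) where
  toFun w := ∑ i, (q i * (w ⬝ᵥ v i)) • v i + (w ⬝ᵥ u) • u
  map_add' w w' := by
    simp only [add_dotProduct, mul_add, add_smul, Finset.sum_add_distrib]
    abel
  map_smul' c w := by
    simp only [smul_dotProduct, smul_eq_mul, RingHom.id_apply, smul_add, Finset.smul_sum,
      smul_smul]
    congr 1
    exact Finset.sum_congr rfl fun i _ => by rw [mul_left_comm]

theorem hessian_apply (q : ι → ℝ) (w : κ → ℝ) :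
    hessian v u q w = ∑ i, (q i * (w ⬝ᵥ v i)) • v i + (w ⬝ᵥ u) • u := rfl

theorem hessian_injective {q : ι → ℝ} (hq : ∀ i, 0 ≤ q i) (h : Spanning v u q) :
    Function.Injective (hessian v u q) := by
  rw [← LinearMap.ker_eq_bot, LinearMap.ker_eq_bot']
  intro w hw
  have h1 : w ⬝ᵥ hessian v u q w = 0 := by rw [hw, dotProduct_zero]
  have h2 : ∑ i, q i * (w ⬝ᵥ v i) ^ 2 + (w ⬝ᵥ u) ^ 2 = 0 := by
    rw [← h1, hessian_apply, dotProduct_add, dotProduct_sum, dotProduct_smul]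
    congr 1
    · refine Finset.sum_congr rfl fun i _ => ?_
      rw [dotProduct_smul, smul_eq_mul]; ring
    · rw [smul_eq_mul]; ring
  have h4 : ∀ i ∈ Finset.univ, 0 ≤ q i * (w ⬝ᵥ v i) ^ 2 :=
    fun i _ => mul_nonneg (hq i) (sq_nonneg _)
  have h5 := Finset.sum_nonneg h4
  have h6 : (w ⬝ᵥ u) ^ 2 = 0 := by nlinarith [sq_nonneg (w ⬝ᵥ u)]
  have h7 := (Finset.sum_eq_zero_iff_of_nonneg h4).1 (by linarith)
  refine h w (by simpa using h6) fun i hi => ?_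
  have h8 := (mul_eq_zero.1 (h7 i (Finset.mem_univ i))).resolve_left hi
  simpa using h8

/-- The critical points depend smoothly on the coefficients. -/
theorem exists_contDiffAt_critical (hp : ∀ i, 0 ≤ p i) (h : Spanning v u p) {t : κ → ℝ}
    (ht : gradient v u p t = 0) :
    ∃ ψ : (ι → ℝ) → κ → ℝ, ContDiffAt ℝ ∞ ψ p ∧ ∀ᶠ q in 𝓝 p, gradient v u q (ψ q) = 0 := by
  have hG := (contDiff_gradient (v := v) (u := u)).contDiffAt (x := (p, t))
  -- The partial derivative in `t` is the Hessian with weights pᵢ exp⟨t, vᵢ⟩. These have the support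
  -- of `p`, so it is invertible and the implicit function theorem applies.
  have hD : (((fderiv ℝ (fun q : (ι → ℝ) × (κ → ℝ) => gradient v u q.1 q.2) (p, t)).comp
      (ContinuousLinearMap.inr ℝ (ι → ℝ) (κ → ℝ))) : (κ → ℝ) →L[ℝ] (κ → ℝ)) =
      (hessian v u fun i => p i * Real.exp (t ⬝ᵥ v i)).toContinuousLinearMap := by
    ext1 w
    have hc : HasDerivAt (fun s : ℝ => ((p, t + s • w) : (ι → ℝ) × (κ → ℝ))) (0, w) 0 := by
      refine (hasDerivAt_const _ _).prodMk ?_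
      simpa using ((hasDerivAt_id (0 : ℝ)).smul_const w).const_add t
    have h1 : HasDerivAt (fun s : ℝ => gradient v u p (t + s • w))
        (fderiv ℝ (fun q : (ι → ℝ) × (κ → ℝ) => gradient v u q.1 q.2) (p, t) (0, w)) 0 := by
      have h0 : (p, t) = ((p, t + (0 : ℝ) • w) : (ι → ℝ) × (κ → ℝ)) := by simp
      have := (hG.differentiableAt (by simp)).hasFDerivAt
      exact this.comp_hasDerivAt_of_eq (0 : ℝ) hc h0
    have hl (z : κ → ℝ) : HasDerivAt (fun s : ℝ => (t + s • w) ⬝ᵥ z) (w ⬝ᵥ z) 0 := by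
      have : (fun s : ℝ => (t + s • w) ⬝ᵥ z) = fun s => t ⬝ᵥ z + s * (w ⬝ᵥ z) := by
        funext s; simp [add_dotProduct]
      rw [this]
      simpa using ((hasDerivAt_id (0 : ℝ)).mul_const (w ⬝ᵥ z)).const_add (t ⬝ᵥ z)
    have h2 : HasDerivAt (fun s : ℝ => gradient v u p (t + s • w))
        (hessian v u (fun i => p i * Real.exp (t ⬝ᵥ v i)) w) 0 := by
      have h3 : HasDerivAt (fun s : ℝ => ∑ i, (p i * Real.exp ((t + s • w) ⬝ᵥ v i)) • v i)
          (∑ i, (p i * (Real.exp ((t + (0 : ℝ) • w) ⬝ᵥ v i) * (w ⬝ᵥ v i))) • v i) 0 :=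
        HasDerivAt.fun_sum fun i _ => (((hl (v i)).exp).const_mul (p i)).smul_const (v i)
      refine (h3.add ((hl u).smul_const u)).congr_deriv ?_
      rw [hessian_apply]
      simp only [zero_smul, add_zero, mul_assoc]
    exact h1.unique h2
  have hinv : ((fderiv ℝ (fun q : (ι → ℝ) × (κ → ℝ) => gradient v u q.1 q.2) (p, t)).comp
      (ContinuousLinearMap.inr ℝ (ι → ℝ) (κ → ℝ))).IsInvertible := by
    rw [hD]
    refine ⟨(LinearEquiv.ofInjectiveEndo _ (hessian_injective (v := v) (u := u)
      (q := fun i => p i * Real.exp (t ⬝ᵥ v i)) (fun i => ?_) ?_)).toContinuousLinearEquiv, ?_⟩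
    · exact mul_nonneg (hp i) (Real.exp_pos _).le
    · intro w hw1 hw2
      exact h w hw1 fun i hi => hw2 i (mul_ne_zero hi (Real.exp_pos _).ne')
    · ext1 w; rfl
  refine ⟨hG.implicitFunction (by simp) hinv, hG.contDiffAt_implicitFunction (by simp) hinv, ?_⟩
  filter_upwards [hG.eventually_apply_implicitFunction (by simp) hinv] with q hq
  exact hq.trans ht

/-- A chosen critical point. -/
noncomputable def critical (v : ι → κ → ℝ) (u : κ → ℝ) (p : ι → ℝ) : κ → ℝ :=
  Classical.epsilon fun t => gradient v u p t = 0

theorem gradient_critical (h : ∃ t, gradient v u p t = 0) :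
    gradient v u p (critical v u p) = 0 :=
  Classical.epsilon_spec h

/-- Positive spanning is needed only at `X`. Near `X` critical points come from the implicit
function theorem, and supports can only grow, so spanning persists there; uniqueness then identifies
the arbitrary choice `critical` with the smooth branch. -/
theorem contDiffAt_critical_comp {E : Type*} [NormedAddCommGroup E] [NormedSpace ℝ E]
    {q : E → ι → ℝ} {X : E} (hq : ContDiffAt ℝ ∞ q X) (hq0 : ∀ Y i, 0 ≤ q Y i)
    (h : PosSpanning v u (q X)) : ContDiffAt ℝ ∞ (fun Y => critical v u (q Y)) X := by
  obtain ⟨t, ht⟩ := exists_gradient_eq_zero (hq0 X) h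
  obtain ⟨ψ, hψ, hev⟩ := exists_contDiffAt_critical (hq0 X) h.spanning ht
  refine (hψ.comp X hq).congr_of_eventuallyEq ?_
  have hne : ∀ᶠ Y in 𝓝 X, ∀ i, q X i ≠ 0 → q Y i ≠ 0 := by
    rw [eventually_all]
    intro i
    by_cases hi : q X i = 0
    · simp [hi]
    · have hc : ContinuousAt (fun Y => q Y i) X :=
        (continuous_apply i).continuousAt.comp hq.continuousAt
      filter_upwards [hc.eventually_ne hi] with Y hY _ using hY
  filter_upwards [hne, hq.continuousAt.eventually hev] with Y hY hYψ
  refine gradient_injective (hq0 Y) (fun w hw1 hw2 => ?_)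
    ((gradient_critical ⟨_, hYψ⟩).trans hYψ.symm)
  exact h.spanning w hw1 fun i hi => hw2 i (hY i hi)

/-- All `vᵢ` are orthogonal to `u`, so pairing the gradient with `u` leaves only the penalty term.
The penalty thus normalises the critical point without altering the equation. -/
theorem dotProduct_eq_zero_of_gradient_eq_zero (hu : u ⬝ᵥ u ≠ 0) (hv : ∀ i, u ⬝ᵥ v i = 0)
    {t : κ → ℝ} (ht : gradient v u p t = 0) : t ⬝ᵥ u = 0 := by
  have h1 : u ⬝ᵥ gradient v u p t = 0 := by rw [ht, dotProduct_zero]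
  rw [dotProduct_gradient] at h1
  simp only [hv, mul_zero, Finset.sum_const_zero, zero_add] at h1
  exact (mul_eq_zero.1 h1).resolve_right hu

theorem gradient_eq_zero_iff (hu : u ⬝ᵥ u ≠ 0) (hv : ∀ i, u ⬝ᵥ v i = 0) {t : κ → ℝ} :
    gradient v u p t = 0 ↔ t ⬝ᵥ u = 0 ∧ ∑ i, (p i * Real.exp (t ⬝ᵥ v i)) • v i = 0 := by
  constructor
  · intro h
    have h1 := dotProduct_eq_zero_of_gradient_eq_zero hu hv h
    refine ⟨h1, ?_⟩
    simpa [gradient, h1] using h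
  · rintro ⟨h1, h2⟩
    simp [gradient, h1, h2]

/-- Rescaling the coefficients does not change the set of critical points, so the choice made by
`critical` is the same. This is what makes the flow independent of the frame. -/
theorem critical_smul (hu : u ⬝ᵥ u ≠ 0) (hv : ∀ i, u ⬝ᵥ v i = 0) {c : ℝ} (hc : c ≠ 0) :
    critical v u (c • p) = critical v u p := by
  unfold critical
  congr 1
  funext t
  rw [gradient_eq_zero_iff hu hv, gradient_eq_zero_iff hu hv]
  simp only [Pi.smul_apply, smul_eq_mul, mul_assoc, mul_smul c, ← Finset.smul_sum, smul_eq_zero,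
    hc, false_or]

end ExpSum

namespace Gr42

open Set Topology

/-! ### Maps between Grassmannians in affine charts -/

/-- The affine chart as an open partial homeomorphism. -/
noncomputable def chart (p : Split) : OpenPartialHomeomorph Grassmannian Model :=
  chartCore.openPartialHomeomorph (affineChart p) ⟨p, rfl⟩

theorem chart_mem_maximalAtlas (p : Split) :
    chart p ∈ IsManifold.maximalAtlas 𝓘(ℝ, Model) ∞ Grassmannian := by
  apply IsManifold.subset_maximalAtlas
  change chart p ∈ ⋃ (e : PartialEquiv Grassmannian Model) (he : e ∈ chartCore.atlas),
    {chartCore.openPartialHomeomorph e he}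
  simp only [mem_iUnion, mem_singleton_iff]
  exact ⟨affineChart p, ⟨p, rfl⟩, rfl⟩

theorem graphPlane_mem_chart_source (p : Split) (X : Model) :
    graphPlane p X ∈ (chart p).source :=
  (affineChart p).map_target (mem_univ X)

theorem chart_graphPlane (p : Split) (X : Model) : chart p (graphPlane p X) = X :=
  (affineChart p).right_inv (mem_univ X)

theorem graphPlane_chart (p : Split) {L : Grassmannian} (h : L ∈ (chart p).source) :
    graphPlane p (chart p L) = L :=
  (affineChart p).left_inv h

theorem exists_eq_graphPlane (L : Grassmannian) : ∃ p X, L = graphPlane p X := by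
  obtain ⟨p, hp⟩ := exists_mem_affineChart_source L
  exact ⟨p, chart p L, (graphPlane_chart p hp).symm⟩

/-- Permutations, duality and the flow each carry a whole affine chart into a single affine chart,
so their smoothness can be read off one coordinate formula. -/
theorem contMDiffAt_of_graphPlane {F : Grassmannian → Grassmannian} {p q : Split} {X : Model}
    {g : Model → Model} (hg : ContDiffAt ℝ ∞ g X)
    (hF : ∀ Y, F (graphPlane p Y) = graphPlane q (g Y)) :
    ContMDiffAt 𝓘(ℝ, Model) 𝓘(ℝ, Model) ∞ F (graphPlane p X) := by
  have hs := graphPlane_mem_chart_source p X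
  have h1 := contMDiffAt_of_mem_maximalAtlas (chart_mem_maximalAtlas p) hs
  have h2 : ContMDiffAt 𝓘(ℝ, Model) 𝓘(ℝ, Model) ∞ (chart q).symm (g X) :=
    contMDiffAt_symm_of_mem_maximalAtlas (chart_mem_maximalAtlas q) (mem_univ _)
  have h3 : ContMDiffAt 𝓘(ℝ, Model) 𝓘(ℝ, Model) ∞ g (chart p (graphPlane p X)) := by
    rw [chart_graphPlane]; exact contMDiffAt_iff_contDiffAt.2 hg
  have h4 : ContMDiffAt 𝓘(ℝ, Model) 𝓘(ℝ, Model) ∞ (g ∘ chart p) (graphPlane p X) :=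
    h3.comp _ h1
  have h5 : ContMDiffAt 𝓘(ℝ, Model) 𝓘(ℝ, Model) ∞ ((chart q).symm ∘ (g ∘ chart p))
      (graphPlane p X) := by
    refine ContMDiffAt.comp _ ?_ h4
    rwa [Function.comp, chart_graphPlane]
  refine h5.congr_of_eventuallyEq ?_
  filter_upwards [(chart p).open_source.mem_nhds hs] with L hL
  conv_lhs => rw [← graphPlane_chart p hL, hF]
  rfl

/-- Describing the plane by equations rather than by a frame lets images and orthogonals be compared
without renormalising bases. -/
theorem mem_graphPlane {p : Split} {X : Model} {w : Fin 4 → ℂ} :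
    w ∈ (graphPlane p X).1 ↔
      ∀ b, w (p.symm (Sum.inr b)) = ∑ a, X b a * w (p.symm (Sum.inl a)) := by
  have hL (c : Fin 2 → ℂ) (a : Fin 2) :
      (graphFrame p X).mulVec c (p.symm (Sum.inl a)) = c a := by
    simp [graphFrame, Matrix.mulVec, dotProduct, Matrix.one_apply]
  have hR (c : Fin 2 → ℂ) (b : Fin 2) :
      (graphFrame p X).mulVec c (p.symm (Sum.inr b)) = ∑ a, X b a * c a := by
    simp [graphFrame, Matrix.mulVec, dotProduct]
  change w ∈ LinearMap.range (graphFrame p X).mulVecLin ↔ _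
  constructor
  · rintro ⟨c, rfl⟩ b
    simp only [Matrix.mulVecLin_apply, hL, hR]
  · intro h
    refine ⟨fun a => w (p.symm (Sum.inl a)), ?_⟩
    ext i
    obtain ⟨s, rfl⟩ := p.symm.surjective i
    rcases s with a | b
    · rw [Matrix.mulVecLin_apply, hL]
    · rw [Matrix.mulVecLin_apply, hR, h b]

/-- The image of a plane under a linear automorphism. -/
def mapEquiv (e : (Fin 4 → ℂ) ≃ₗ[ℂ] (Fin 4 → ℂ)) (L : Grassmannian) : Grassmannian :=
  ⟨L.1.map e.toLinearMap, by rw [LinearEquiv.finrank_map_eq]; exact L.2⟩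

theorem mem_mapEquiv {e : (Fin 4 → ℂ) ≃ₗ[ℂ] (Fin 4 → ℂ)} {L : Grassmannian} {w : Fin 4 → ℂ} :
    w ∈ (mapEquiv e L).1 ↔ e.symm w ∈ L.1 :=
  Submodule.mem_map_equiv _

theorem mapEquiv_mapEquiv_symm (e : (Fin 4 → ℂ) ≃ₗ[ℂ] (Fin 4 → ℂ)) (L : Grassmannian) :
    mapEquiv e (mapEquiv e.symm L) = L := by
  apply Subtype.ext
  ext w
  simp [mem_mapEquiv]

theorem mapEquiv_symm_mapEquiv (e : (Fin 4 → ℂ) ≃ₗ[ℂ] (Fin 4 → ℂ)) (L : Grassmannian) :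
    mapEquiv e.symm (mapEquiv e L) = L := by
  apply Subtype.ext
  ext w
  simp [mem_mapEquiv]

theorem isFrame_mapEquiv {e : (Fin 4 → ℂ) ≃ₗ[ℂ] (Fin 4 → ℂ)} {L : Grassmannian}
    {A B : Matrix (Fin 4) (Fin 2) ℂ} (hA : IsFrame L A)
    (h : ∀ c, B.mulVec c = e (A.mulVec c)) : IsFrame (mapEquiv e L) B := by
  have h1 : B.mulVecLin = e.toLinearMap ∘ₗ A.mulVecLin := by
    ext1 c
    ext1
    simp only [LinearMap.comp_apply, Matrix.mulVecLin_apply, h]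
    rfl
  change LinearMap.range B.mulVecLin = L.1.map e.toLinearMap
  rw [h1, LinearMap.range_comp, show LinearMap.range A.mulVecLin = L.1 from hA]

/-- The diagonal automorphism with entries `exp (tᵢ / 2)`. -/
noncomputable def diagEquiv (t : Fin 4 → ℝ) : (Fin 4 → ℂ) ≃ₗ[ℂ] (Fin 4 → ℂ) :=
  LinearEquiv.piCongrRight fun i => LinearEquiv.smulOfNeZero ℂ ℂ ((Real.exp (t i / 2) : ℝ) : ℂ)
    (Complex.ofReal_ne_zero.2 (Real.exp_pos _).ne')

theorem diagEquiv_apply (t : Fin 4 → ℝ) (w : Fin 4 → ℂ) (i : Fin 4) :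
    diagEquiv t w i = ((Real.exp (t i / 2) : ℝ) : ℂ) * w i := rfl

theorem diagEquiv_symm (t : Fin 4 → ℝ) : (diagEquiv t).symm = diagEquiv (-t) := by
  ext1 w
  rw [LinearEquiv.symm_apply_eq]
  ext i
  rw [diagEquiv_apply, diagEquiv_apply, ← mul_assoc, ← Complex.ofReal_mul, ← Real.exp_add]
  simp [neg_div]

theorem isFrame_diag {L : Grassmannian} {A : Matrix (Fin 4) (Fin 2) ℂ} (hA : IsFrame L A)
    (t : Fin 4 → ℝ) : IsFrame (mapEquiv (diagEquiv t) L)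
      (Matrix.of fun i k => ((Real.exp (t i / 2) : ℝ) : ℂ) * A i k) := by
  refine isFrame_mapEquiv hA fun c => ?_
  ext i
  simp only [diagEquiv_apply, Matrix.mulVec, dotProduct, Matrix.of_apply, Finset.mul_sum, mul_assoc]

theorem diag_graphPlane (t : Fin 4 → ℝ) (p : Split) (X : Model) :
    mapEquiv (diagEquiv t) (graphPlane p X) = graphPlane p fun b a =>
      ((Real.exp ((t (p.symm (Sum.inr b)) - t (p.symm (Sum.inl a))) / 2) : ℝ) : ℂ) * X b a := by
  apply Subtype.ext
  ext w
  rw [mem_mapEquiv, mem_graphPlane, mem_graphPlane, diagEquiv_symm]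
  refine forall_congr' fun b => ?_
  rw [← mul_right_inj' (a := ((Real.exp (t (p.symm (Sum.inr b)) / 2) : ℝ) : ℂ))
    (Complex.ofReal_ne_zero.2 (Real.exp_pos _).ne'), diagEquiv_apply, ← mul_assoc,
    ← Complex.ofReal_mul, ← Real.exp_add, Finset.mul_sum]
  have h1 : t (p.symm (Sum.inr b)) / 2 + (-t) (p.symm (Sum.inr b)) / 2 = 0 := by
    simp [neg_div]
  rw [h1, Real.exp_zero, Complex.ofReal_one, one_mul]
  have h2 (a : Fin 2) : ((Real.exp (t (p.symm (Sum.inr b)) / 2) : ℝ) : ℂ) *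
      (X b a * diagEquiv (-t) w (p.symm (Sum.inl a))) =
      ((Real.exp ((t (p.symm (Sum.inr b)) - t (p.symm (Sum.inl a))) / 2) : ℝ) : ℂ) * X b a *
        w (p.symm (Sum.inl a)) := by
    rw [diagEquiv_apply, sub_div, sub_eq_add_neg, Real.exp_add, Complex.ofReal_mul, Pi.neg_apply,
      neg_div]
    ring
  simp only [h2]

/-- The permutation of coordinates `(w_k) ↦ (w_{π k})`. -/
noncomputable abbrev permEquiv (π : Equiv.Perm (Fin 4)) : (Fin 4 → ℂ) ≃ₗ[ℂ] (Fin 4 → ℂ) :=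
  LinearEquiv.funCongrLeft ℂ ℂ π

theorem isFrame_perm {L : Grassmannian} {A : Matrix (Fin 4) (Fin 2) ℂ} (hA : IsFrame L A)
    (π : Equiv.Perm (Fin 4)) : IsFrame (mapEquiv (permEquiv π) L) (A.submatrix π id) :=
  isFrame_mapEquiv hA fun _ => rfl

theorem perm_graphPlane (π : Equiv.Perm (Fin 4)) (p : Split) (X : Model) :
    mapEquiv (permEquiv π) (graphPlane p X) = graphPlane (π.trans p) X := by
  apply Subtype.ext
  ext w
  rw [mem_mapEquiv, mem_graphPlane, mem_graphPlane]
  rfl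

/-- The orthogonal complement of a plane with respect to the bilinear form `∑ wᵢ zᵢ`. -/
def orthogonal (L : Submodule ℂ (Fin 4 → ℂ)) : Submodule ℂ (Fin 4 → ℂ) where
  carrier := {w | ∀ z ∈ L, z ⬝ᵥ w = 0}
  add_mem' ha hb z hz := by rw [dotProduct_add, ha z hz, hb z hz, add_zero]
  zero_mem' z _ := dotProduct_zero z
  smul_mem' c w hw z hz := by rw [dotProduct_smul, hw z hz, smul_zero]

/-- The splitting with the two pairs of coordinates exchanged. -/
abbrev swapSplit (p : Split) : Split := p.trans (Equiv.sumComm _ _)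

theorem orthogonal_graphPlane (p : Split) (X : Model) :
    orthogonal (graphPlane p X).1 = (graphPlane (swapSplit p) fun b a => -X a b).1 := by
  ext w
  rw [mem_graphPlane]
  have hdot (z : Fin 4 → ℂ) : z ⬝ᵥ w = ∑ a, z (p.symm (Sum.inl a)) * w (p.symm (Sum.inl a)) +
      ∑ b, z (p.symm (Sum.inr b)) * w (p.symm (Sum.inr b)) := by
    rw [dotProduct, ← Equiv.sum_comp p.symm, Fintype.sum_sum_type]
  constructor
  · intro h b
    have h1 : (graphFrame p X).col b ∈ (graphPlane p X).1 := by
      rw [mem_graphPlane]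
      intro b'
      simp [graphFrame, Matrix.one_apply]
    have h2 := h _ h1
    rw [hdot] at h2
    simp only [graphFrame, Matrix.col_apply, Matrix.of_apply, Equiv.apply_symm_apply, Sum.elim_inl,
      Sum.elim_inr, Matrix.one_apply, ite_mul, one_mul, zero_mul, Finset.sum_ite_eq',
      Finset.mem_univ, if_true] at h2
    simp only [neg_mul, Finset.sum_neg_distrib]
    exact eq_neg_of_add_eq_zero_left h2
  · intro h z hz
    rw [mem_graphPlane] at hz
    rw [hdot]
    have h' : ∀ b, w (p.symm (Sum.inl b)) = ∑ a, -X a b * w (p.symm (Sum.inr a)) := h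
    simp only [hz, h', Fin.sum_univ_two]
    ring

/-- The orthogonal complement, as a map of the Grassmannian to itself. -/
def dual (L : Grassmannian) : Grassmannian :=
  ⟨orthogonal L.1, by
    obtain ⟨p, X, rfl⟩ := exists_eq_graphPlane L
    rw [orthogonal_graphPlane]
    exact (graphPlane _ _).2⟩

theorem dual_graphPlane (p : Split) (X : Model) :
    dual (graphPlane p X) = graphPlane (swapSplit p) fun b a => -X a b :=
  Subtype.ext (orthogonal_graphPlane p X)

theorem dual_dual (L : Grassmannian) : dual (dual L) = L := by
  obtain ⟨p, X, rfl⟩ := exists_eq_graphPlane L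
  rw [dual_graphPlane, dual_graphPlane]
  congr 1
  · ext1 i
    simp
  · simp

theorem contMDiff_perm (π : Equiv.Perm (Fin 4)) :
    ContMDiff 𝓘(ℝ, Model) 𝓘(ℝ, Model) ∞ (mapEquiv (permEquiv π)) := by
  intro L
  obtain ⟨p, X, rfl⟩ := exists_eq_graphPlane L
  exact contMDiffAt_of_graphPlane contDiffAt_id fun Y => perm_graphPlane π p Y

theorem contMDiff_dual : ContMDiff 𝓘(ℝ, Model) 𝓘(ℝ, Model) ∞ dual := by
  intro L
  obtain ⟨p, X, rfl⟩ := exists_eq_graphPlane L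
  refine contMDiffAt_of_graphPlane (g := fun Y b a => -Y a b) ?_ fun Y => dual_graphPlane p Y
  exact ContDiff.contDiffAt (by fun_prop)

/-! ### Plücker weights and the moment map -/

/-- The `2 × 2` minor of `A` on the rows `i, j`. -/
def rowDet (A : Matrix (Fin 4) (Fin 2) ℂ) (i j : Fin 4) : ℂ := A i 0 * A j 1 - A i 1 * A j 0

/-- The squared absolute values of the Plücker coordinates. -/
noncomputable def pluckerWeight (A : Matrix (Fin 4) (Fin 2) ℂ) (I : Pair) : ℝ := ‖minor A I‖ ^ 2

/-- The unnormalised moment map. -/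
noncomputable def rowWeight (A : Matrix (Fin 4) (Fin 2) ℂ) (k : Fin 4) : ℝ :=
  ∑ j, ‖rowDet A k j‖ ^ 2

theorem pluckerWeight_nonneg (A : Matrix (Fin 4) (Fin 2) ℂ) (I : Pair) : 0 ≤ pluckerWeight A I :=
  sq_nonneg _

theorem rowDet_self (A : Matrix (Fin 4) (Fin 2) ℂ) (i : Fin 4) : rowDet A i i = 0 := by
  unfold rowDet; ring

theorem rowDet_comm (A : Matrix (Fin 4) (Fin 2) ℂ) (i j : Fin 4) :
    rowDet A i j = -rowDet A j i := by
  unfold rowDet; ring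

theorem norm_rowDet_comm (A : Matrix (Fin 4) (Fin 2) ℂ) (i j : Fin 4) :
    ‖rowDet A i j‖ = ‖rowDet A j i‖ := by
  rw [rowDet_comm, norm_neg]

theorem sum_pair {M : Type*} [AddCommMonoid M] (f : Pair → M) :
    ∑ I, f I = f ⟨(0, 1), by decide⟩ + f ⟨(0, 2), by decide⟩ + f ⟨(0, 3), by decide⟩ +
      f ⟨(1, 2), by decide⟩ + f ⟨(1, 3), by decide⟩ + f ⟨(2, 3), by decide⟩ := by
  have : (Finset.univ : Finset Pair) = {⟨(0, 1), by decide⟩, ⟨(0, 2), by decide⟩,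
    ⟨(0, 3), by decide⟩, ⟨(1, 2), by decide⟩, ⟨(1, 3), by decide⟩, ⟨(2, 3), by decide⟩} := by
    decide
  rw [this]
  simp [add_assoc]

theorem sum_pluckerWeight (A : Matrix (Fin 4) (Fin 2) ℂ) :
    ∑ I, pluckerWeight A I = ‖rowDet A 0 1‖ ^ 2 + ‖rowDet A 0 2‖ ^ 2 + ‖rowDet A 0 3‖ ^ 2 +
      ‖rowDet A 1 2‖ ^ 2 + ‖rowDet A 1 3‖ ^ 2 + ‖rowDet A 2 3‖ ^ 2 :=
  sum_pair _

theorem sum_rowWeight (A : Matrix (Fin 4) (Fin 2) ℂ) :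
    ∑ k, rowWeight A k = 2 * ∑ I, pluckerWeight A I := by
  simp only [rowWeight, sum_pluckerWeight, Fin.sum_univ_four, rowDet_self,
    norm_rowDet_comm A 1 0, norm_rowDet_comm A 2 0, norm_rowDet_comm A 3 0,
    norm_rowDet_comm A 2 1, norm_rowDet_comm A 3 1, norm_rowDet_comm A 3 2]
  simp
  ring

theorem sum_pluckerWeight_mul_weight (A : Matrix (Fin 4) (Fin 2) ℂ) (k : Fin 4) :
    ∑ I, pluckerWeight A I * weight I k = rowWeight A k := by
  simp only [rowWeight, sum_pair, Fin.sum_univ_four]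
  change ‖rowDet A 0 1‖ ^ 2 * _ + ‖rowDet A 0 2‖ ^ 2 * _ + ‖rowDet A 0 3‖ ^ 2 * _ +
    ‖rowDet A 1 2‖ ^ 2 * _ + ‖rowDet A 1 3‖ ^ 2 * _ + ‖rowDet A 2 3‖ ^ 2 * _ = _
  fin_cases k <;>
  simp [weight, rowDet_self, norm_rowDet_comm A 1 0, norm_rowDet_comm A 2 0,
    norm_rowDet_comm A 3 0, norm_rowDet_comm A 2 1, norm_rowDet_comm A 3 1,
    norm_rowDet_comm A 3 2]

theorem pluckerWeight_eq_smul {L : Grassmannian} {A B : Matrix (Fin 4) (Fin 2) ℂ}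
    (hA : IsFrame L A) (hB : IsFrame L B) :
    ∃ c : ℝ, 0 < c ∧ pluckerWeight A = c • pluckerWeight B := by
  obtain ⟨c, hc, h⟩ := plucker_eq hA
  obtain ⟨d, hd, h'⟩ := plucker_eq hB
  refine ⟨(‖c‖ / ‖d‖) ^ 2, by positivity, ?_⟩
  ext I
  have hd' : ‖d‖ ≠ 0 := by simpa using hd
  simp only [pluckerWeight, h, h', norm_mul, Pi.smul_apply, smul_eq_mul]
  field_simp

/-- Up to sign the six minors of a graph frame are 1, the four entries of `X`, and det `X`. -/
theorem rowWeight_graphFrame (p : Split) (X : Model) :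
    rowWeight (graphFrame p X) (p.symm (Sum.inl 0)) = 1 + ‖X 0 1‖ ^ 2 + ‖X 1 1‖ ^ 2 ∧
    rowWeight (graphFrame p X) (p.symm (Sum.inl 1)) = 1 + ‖X 0 0‖ ^ 2 + ‖X 1 0‖ ^ 2 ∧
    rowWeight (graphFrame p X) (p.symm (Sum.inr 0)) =
      ‖X 0 0‖ ^ 2 + ‖X 0 1‖ ^ 2 + ‖X 0 0 * X 1 1 - X 0 1 * X 1 0‖ ^ 2 ∧
    rowWeight (graphFrame p X) (p.symm (Sum.inr 1)) =
      ‖X 1 0‖ ^ 2 + ‖X 1 1‖ ^ 2 + ‖X 0 0 * X 1 1 - X 0 1 * X 1 0‖ ^ 2 := by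
  have h (k : Fin 4) : rowWeight (graphFrame p X) k =
      ∑ s, ‖rowDet (graphFrame p X) k (p.symm s)‖ ^ 2 :=
    (Equiv.sum_comp p.symm fun j => ‖rowDet (graphFrame p X) k j‖ ^ 2).symm
  have h10 : ‖X 0 1 * X 1 0 - X 0 0 * X 1 1‖ = ‖X 0 0 * X 1 1 - X 0 1 * X 1 0‖ :=
    norm_sub_rev _ _
  refine ⟨?_, ?_, ?_, ?_⟩ <;>
  · rw [h]
    simp [Fintype.sum_sum_type, rowDet, graphFrame, mul_comm, h10]
    try ring

theorem sum_pluckerWeight_graphFrame (p : Split) (X : Model) :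
    ∑ I, pluckerWeight (graphFrame p X) I = 1 + ‖X 0 0‖ ^ 2 + ‖X 0 1‖ ^ 2 + ‖X 1 0‖ ^ 2 +
      ‖X 1 1‖ ^ 2 + ‖X 0 0 * X 1 1 - X 0 1 * X 1 0‖ ^ 2 := by
  have h := sum_rowWeight (graphFrame p X)
  rw [← Equiv.sum_comp p.symm, Fintype.sum_sum_type, Fin.sum_univ_two, Fin.sum_univ_two] at h
  obtain ⟨h1, h2, h3, h4⟩ := rowWeight_graphFrame p X
  linarith

theorem sum_pluckerWeight_pos {L : Grassmannian} {A : Matrix (Fin 4) (Fin 2) ℂ}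
    (hA : IsFrame L A) : 0 < ∑ I, pluckerWeight A I := by
  obtain ⟨p, X, rfl⟩ := exists_eq_graphPlane L
  obtain ⟨c, hc, h⟩ := pluckerWeight_eq_smul hA (isFrame_graphPlane p X)
  simp only [h, Pi.smul_apply, smul_eq_mul, ← Finset.mul_sum, sum_pluckerWeight_graphFrame]
  positivity

theorem momentMap_apply {L : Grassmannian} {A : Matrix (Fin 4) (Fin 2) ℂ} (hA : IsFrame L A)
    (k : Fin 4) : momentMap L k = rowWeight A k / ∑ I, pluckerWeight A I := by
  rw [momentMap_eq hA, ← sum_pluckerWeight_mul_weight]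
  simp only [Pi.smul_apply, Finset.sum_apply, smul_eq_mul, pluckerWeight]
  rw [div_eq_inv_mul]

/-- Clearing the denominator turns the level condition into the critical equation of the exponential
sum at `t = 0`. -/
theorem momentMap_eq_iff {L : Grassmannian} {A : Matrix (Fin 4) (Fin 2) ℂ} (hA : IsFrame L A)
    {x : Fin 4 → ℝ} : momentMap L = x ↔ ∑ I, pluckerWeight A I • (weight I - x) = 0 := by
  have hpos := sum_pluckerWeight_pos hA
  rw [funext_iff, funext_iff]
  refine forall_congr' fun k => ?_
  rw [momentMap_apply hA, div_eq_iff hpos.ne', ← sum_pluckerWeight_mul_weight]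
  simp only [Finset.sum_apply, Pi.smul_apply, Pi.sub_apply, smul_eq_mul, mul_sub,
    Finset.sum_sub_distrib, Pi.zero_apply, ← Finset.sum_mul, sub_eq_zero]
  rw [mul_comm]

theorem momentMap_perm (π : Equiv.Perm (Fin 4)) (L : Grassmannian) :
    momentMap (mapEquiv (permEquiv π) L) = momentMap L ∘ π := by
  have hA := isFrame_frame L
  have hB := isFrame_perm hA π
  have h1 (k : Fin 4) :
      rowWeight ((frame L).submatrix π id) k = rowWeight (frame L) (π k) :=
    Equiv.sum_comp π fun j => ‖rowDet (frame L) (π k) j‖ ^ 2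
  have h2 : ∑ I, pluckerWeight ((frame L).submatrix π id) I = ∑ I, pluckerWeight (frame L) I := by
    have h3 := sum_rowWeight ((frame L).submatrix π id)
    simp only [h1] at h3
    rw [Equiv.sum_comp π (rowWeight (frame L)), sum_rowWeight] at h3
    linarith
  ext k
  rw [momentMap_apply hB, Function.comp, momentMap_apply hA, h1, h2]

/-- Passing from X to −Xᵀ over the exchanged splitting preserves the absolute values of the minors
but moves each to the complementary pair, and Λ of the complement of I is 1 − Λ_I. -/
theorem momentMap_dual (L : Grassmannian) : momentMap (dual L) = 1 - momentMap L := by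
  obtain ⟨p, X, rfl⟩ := exists_eq_graphPlane L
  rw [dual_graphPlane]
  ext k
  have hA := isFrame_graphPlane p X
  have hB := isFrame_graphPlane (swapSplit p) fun b a => -X a b
  rw [Pi.sub_apply, momentMap_apply hA, momentMap_apply hB]
  have hN := sum_pluckerWeight_pos hA
  have hN' : ∑ I, pluckerWeight (graphFrame (swapSplit p) fun b a => -X a b) I =
      ∑ I, pluckerWeight (graphFrame p X) I := by
    rw [sum_pluckerWeight_graphFrame, sum_pluckerWeight_graphFrame]
    simp only [norm_neg, neg_mul_neg, mul_comm (X 1 0)]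
    ring
  rw [hN', eq_sub_iff_add_eq, ← add_div, Pi.one_apply, div_eq_one_iff_eq hN.ne', sum_pluckerWeight_graphFrame]
  obtain ⟨h1, h2, h3, h4⟩ := rowWeight_graphFrame p X
  obtain ⟨h1', h2', h3', h4'⟩ := rowWeight_graphFrame (swapSplit p) fun b a => -X a b
  have e (s : Fin 2 ⊕ Fin 2) : (swapSplit p).symm s = p.symm s.swap := rfl
  simp only [e, Sum.swap_inl, Sum.swap_inr, norm_neg, neg_mul_neg, mul_comm (X 1 0)]
    at h1' h2' h3' h4'
  obtain ⟨s, rfl⟩ := p.symm.surjective k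
  rcases s with a | b
  · fin_cases a
    · simp only [Fin.zero_eta, h1, h3']; ring
    · simp only [Fin.mk_one, h2, h4']; ring
  · fin_cases b
    · simp only [Fin.zero_eta, h3, h1']; ring
    · simp only [Fin.mk_one, h4, h2']; ring

end Gr42

namespace Gr42

open Set Topology ExpSum

/-! ### The positive diagonal action -/

theorem sum_weight (I : Pair) : ∑ k, weight I k = 2 := by
  have : ∀ k, weight I k = (if k = I.1.1 then 1 else 0) + (if k = I.1.2 then 1 else 0) := by
    intro k
    unfold weight
    by_cases h1 : k = I.1.1
    · simp [h1, I.2.ne]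
    · simp [h1]
  simp only [this, Finset.sum_add_distrib, Finset.sum_ite_eq', Finset.mem_univ, if_true]
  norm_num

theorem dotProduct_weight (t : Fin 4 → ℝ) (I : Pair) : t ⬝ᵥ weight I = t I.1.1 + t I.1.2 := by
  have : ∀ k, t k * weight I k =
      (if k = I.1.1 then t k else 0) + (if k = I.1.2 then t k else 0) := by
    intro k
    unfold weight
    by_cases h1 : k = I.1.1
    · simp [h1, I.2.ne]
    · simp [h1]
  simp only [dotProduct, this, Finset.sum_add_distrib, Finset.sum_ite_eq', Finset.mem_univ,
    if_true]

theorem one_dotProduct_one_ne_zero : (1 : Fin 4 → ℝ) ⬝ᵥ 1 ≠ 0 := by simp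

theorem one_dotProduct_weight_sub {x : Fin 4 → ℝ} (hx : ∑ k, x k = 2) (I : Pair) :
    (1 : Fin 4 → ℝ) ⬝ᵥ (weight I - x) = 0 := by
  rw [one_dotProduct]
  simp only [Pi.sub_apply, Finset.sum_sub_distrib, sum_weight, hx, sub_self]

/-- The halves in `diagEquiv` cancel against the squares, leaving exactly exp⟨t, Λ_I⟩. -/
theorem pluckerWeight_diag (t : Fin 4 → ℝ) (A : Matrix (Fin 4) (Fin 2) ℂ) (I : Pair) :
    pluckerWeight (Matrix.of fun i k => ((Real.exp (t i / 2) : ℝ) : ℂ) * A i k) I =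
      pluckerWeight A I * Real.exp (t ⬝ᵥ weight I) := by
  have h : minor (Matrix.of fun i k => ((Real.exp (t i / 2) : ℝ) : ℂ) * A i k) I =
      ((Real.exp (t ⬝ᵥ weight I / 2) : ℝ) : ℂ) * minor A I := by
    rw [dotProduct_weight, add_div, Real.exp_add, Complex.ofReal_mul]
    simp only [minor, Matrix.of_apply]
    ring
  have h2 : Real.exp (t ⬝ᵥ weight I / 2) ^ 2 = Real.exp (t ⬝ᵥ weight I) := by
    rw [← Real.exp_nat_mul]; congr 1; push_cast; ring
  rw [pluckerWeight, h, norm_mul, mul_pow, Complex.norm_real, Real.norm_eq_abs, sq_abs, h2,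
    mul_comm, pluckerWeight]

theorem contDiff_pluckerWeight (p : Split) :
    ContDiff ℝ ∞ fun X : Model => pluckerWeight (graphFrame p X) := by
  rw [contDiff_pi]
  intro I
  have h := contDiff_graphFrame p
  have h2 : ContDiff ℝ ∞ fun X : Model => minor (graphFrame p X) I :=
    ((h _ _).mul (h _ _)).sub ((h _ _).mul (h _ _))
  exact h2.norm_sq ℝ

/-- Move a plane by the positive diagonal group onto the level set over `y`. -/
noncomputable def flow (y : Fin 4 → ℝ) (L : Grassmannian) : Grassmannian :=
  mapEquiv (diagEquiv (critical (fun I => weight I - y) 1 (pluckerWeight (frame L)))) L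

theorem flow_eq {y : Fin 4 → ℝ} (hy : ∑ k, y k = 2) {L : Grassmannian}
    {A : Matrix (Fin 4) (Fin 2) ℂ} (hA : IsFrame L A) :
    flow y L = mapEquiv (diagEquiv (critical (fun I => weight I - y) 1 (pluckerWeight A))) L := by
  obtain ⟨c, hc, h⟩ := pluckerWeight_eq_smul (isFrame_frame L) hA
  rw [flow, h, critical_smul one_dotProduct_one_ne_zero (one_dotProduct_weight_sub hy) hc.ne']

/-- The weights of a plane positively span at level `y`. -/
def Stable (y : Fin 4 → ℝ) (L : Grassmannian) : Prop :=
  ∀ A, IsFrame L A → PosSpanning (fun I => weight I - y) 1 (pluckerWeight A)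

/-- In an affine chart the flow multiplies the entries of `X` by exponentials of differences of
coordinates of the critical point, which varies smoothly with `X`. -/
theorem contMDiffAt_flow {y : Fin 4 → ℝ} (hy : ∑ k, y k = 2) {L : Grassmannian}
    (hL : Stable y L) : ContMDiffAt 𝓘(ℝ, Model) 𝓘(ℝ, Model) ∞ (flow y) L := by
  obtain ⟨p, X, rfl⟩ := exists_eq_graphPlane L
  have hc := contDiffAt_critical_comp (v := fun I => weight I - y) (u := 1)
    (contDiff_pluckerWeight p).contDiffAt
    (fun Y I => pluckerWeight_nonneg (graphFrame p Y) I) (hL _ (isFrame_graphPlane p X))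
  refine contMDiffAt_of_graphPlane ?_ fun Y => by
    rw [flow_eq hy (isFrame_graphPlane p Y), diag_graphPlane]
  rw [contDiffAt_pi]
  intro b
  rw [contDiffAt_pi]
  intro a
  have hci (i : Fin 4) : ContDiffAt ℝ ∞ (fun Y =>
      critical (fun I => weight I - y) 1 (pluckerWeight (graphFrame p Y)) i) X :=
    (contDiff_apply ℝ ℝ i).contDiffAt.comp X hc
  have h1 := (((hci (p.symm (Sum.inr b))).sub (hci (p.symm (Sum.inl a)))).div_const 2).exp
  refine ContDiffAt.mul (Complex.ofRealCLM.contDiff.contDiffAt.comp X h1) ?_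
  exact ContDiff.contDiffAt (by fun_prop)

/-- Replacing the weights Λ_I by Λ_I − y in the exponents costs only a common positive factor, so
the moment equation for the moved plane is the critical equation. -/
theorem sum_exp_diag {y : Fin 4 → ℝ} (q : Pair → ℝ) (t : Fin 4 → ℝ) :
    ∑ I, (q I * Real.exp (t ⬝ᵥ weight I)) • (weight I - y) =
      Real.exp (t ⬝ᵥ y) • ∑ I, (q I * Real.exp (t ⬝ᵥ (weight I - y))) • (weight I - y) := by
  rw [Finset.smul_sum]
  refine Finset.sum_congr rfl fun I _ => ?_
  rw [smul_smul, mul_left_comm, ← Real.exp_add, dotProduct_sub, add_sub_cancel]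

theorem momentMap_flow {y : Fin 4 → ℝ} (hy : ∑ k, y k = 2) {L : Grassmannian}
    (hL : Stable y L) : momentMap (flow y L) = y := by
  have hA := isFrame_frame L
  have h1 := gradient_critical (exists_gradient_eq_zero (pluckerWeight_nonneg _) (hL _ hA))
  rw [gradient_eq_zero_iff one_dotProduct_one_ne_zero (one_dotProduct_weight_sub hy)] at h1
  rw [flow, momentMap_eq_iff (isFrame_diag hA _)]
  simp only [pluckerWeight_diag]
  rw [sum_exp_diag, h1.2, smul_zero]

/-- If `t` moves `L` to level `y`, then `-t` solves the critical equation of the moved plane at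
level `x`, because `L` itself lies over `x`. By uniqueness it is the solution chosen by `flow x`. -/
theorem flow_flow {x y : Fin 4 → ℝ} (hx : ∑ k, x k = 2) (hy : ∑ k, y k = 2) {L : Grassmannian}
    (hLx : momentMap L = x) (hL : Stable y L) (hL' : Stable x (flow y L)) :
    flow x (flow y L) = L := by
  have hA := isFrame_frame L
  set t := critical (fun I => weight I - y) 1 (pluckerWeight (frame L)) with ht
  have hF : flow y L = mapEquiv (diagEquiv t) L := rfl
  have hB := isFrame_diag hA t
  have h1 := gradient_critical (exists_gradient_eq_zero (pluckerWeight_nonneg _) (hL _ hA))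
  rw [← ht] at h1
  have ht0 := dotProduct_eq_zero_of_gradient_eq_zero one_dotProduct_one_ne_zero
    (one_dotProduct_weight_sub hy) h1
  have h2 : gradient (fun I => weight I - x) 1 (pluckerWeight (Matrix.of fun i k =>
      ((Real.exp (t i / 2) : ℝ) : ℂ) * frame L i k)) (-t) = 0 := by
    rw [gradient_eq_zero_iff one_dotProduct_one_ne_zero (one_dotProduct_weight_sub hx)]
    refine ⟨by rw [neg_dotProduct, ht0, neg_zero], ?_⟩
    have h3 : ∀ I, pluckerWeight (Matrix.of fun i k =>
        ((Real.exp (t i / 2) : ℝ) : ℂ) * frame L i k) I * Real.exp (-t ⬝ᵥ (weight I - x)) =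
        Real.exp (t ⬝ᵥ x) * pluckerWeight (frame L) I := by
      intro I
      rw [pluckerWeight_diag, mul_assoc, ← Real.exp_add, mul_comm]
      congr 2
      rw [neg_dotProduct, dotProduct_sub]
      ring
    simp only [h3, mul_smul, ← Finset.smul_sum]
    rw [(momentMap_eq_iff hA).1 hLx, smul_zero]
  rw [hF] at hL' ⊢
  have h4 := gradient_critical ⟨_, h2⟩
  have h5 := gradient_injective (pluckerWeight_nonneg _) (hL' _ hB).spanning (h4.trans h2.symm)
  rw [flow_eq hx hB, h5, ← diagEquiv_symm, mapEquiv_symm_mapEquiv]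

/-! ### Equivalence of level sets -/

/-- The level sets over `x` and `y` are exchanged by mutually inverse maps which are smooth in the
ambient Grassmannian. -/
def LevelEquiv (x y : Fin 4 → ℝ) : Prop :=
  ∃ F G : Grassmannian → Grassmannian,
    (∀ L, momentMap L = x → ContMDiffAt 𝓘(ℝ, Model) 𝓘(ℝ, Model) ∞ F L ∧ momentMap (F L) = y ∧
      G (F L) = L) ∧
    (∀ L, momentMap L = y → ContMDiffAt 𝓘(ℝ, Model) 𝓘(ℝ, Model) ∞ G L ∧ momentMap (G L) = x ∧
      F (G L) = L)

theorem LevelEquiv.symm {x y : Fin 4 → ℝ} (h : LevelEquiv x y) : LevelEquiv y x := by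
  obtain ⟨F, G, h1, h2⟩ := h
  exact ⟨G, F, h2, h1⟩

theorem LevelEquiv.trans {x y z : Fin 4 → ℝ} (h : LevelEquiv x y) (h' : LevelEquiv y z) :
    LevelEquiv x z := by
  obtain ⟨F, G, h1, h2⟩ := h
  obtain ⟨F', G', h1', h2'⟩ := h'
  refine ⟨F' ∘ F, G ∘ G', fun L hL => ?_, fun L hL => ?_⟩
  · obtain ⟨a, b, c⟩ := h1 L hL
    obtain ⟨a', b', c'⟩ := h1' _ b
    exact ⟨a'.comp L a, b', by simp only [Function.comp, c', c]⟩
  · obtain ⟨a, b, c⟩ := h2' L hL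
    obtain ⟨a', b', c'⟩ := h2 _ b
    exact ⟨a'.comp L a, b', by simp only [Function.comp, c', c]⟩

theorem levelEquiv_perm (π : Equiv.Perm (Fin 4)) (x : Fin 4 → ℝ) : LevelEquiv x (x ∘ π) := by
  have hs : (permEquiv π).symm = permEquiv π.symm := rfl
  refine ⟨mapEquiv (permEquiv π), mapEquiv (permEquiv π).symm, fun L hL => ⟨contMDiff_perm π L,
    by rw [momentMap_perm, hL], mapEquiv_symm_mapEquiv _ L⟩, fun L hL => ⟨contMDiff_perm π.symm L,
    ?_, mapEquiv_mapEquiv_symm _ L⟩⟩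
  rw [hs, momentMap_perm, hL]
  ext k
  simp

theorem levelEquiv_one_sub (x : Fin 4 → ℝ) : LevelEquiv x (1 - x) :=
  ⟨dual, dual, fun L hL => ⟨contMDiff_dual L, by rw [momentMap_dual, hL], dual_dual L⟩,
    fun L hL => ⟨contMDiff_dual L, by rw [momentMap_dual, hL, sub_sub_cancel], dual_dual L⟩⟩

/-- Equivalent level sets are diffeomorphic for any embedded smooth structures. -/
theorem LevelEquiv.nonempty_diffeomorph {x y : Fin 4 → ℝ} (h : LevelEquiv x y) {n : ℕ}
    (c : ChartedSpace (EuclideanSpace ℝ (Fin n)) (levelSet x))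
    (d : ChartedSpace (EuclideanSpace ℝ (Fin n)) (levelSet y))
    (hc : IsSubmanifoldAtlas n (levelSet x) c) (hd : IsSubmanifoldAtlas n (levelSet y) d) :
    Nonempty (Diffeomorph (𝓡 n) (𝓡 n) (levelSet x) (levelSet y) ∞) := by
  obtain ⟨F, G, hF, hG⟩ := h
  obtain ⟨hcm, hce⟩ := hc
  obtain ⟨hdm, hde⟩ := hd
  let f : levelSet x → levelSet y := fun L => ⟨F L, (hF L L.2).2.1⟩
  let g : levelSet y → levelSet x := fun L => ⟨G L, (hG L L.2).2.1⟩
  have hfs : ContMDiff (𝓡 n) 𝓘(ℝ, Model) ∞ (Subtype.val ∘ f) := fun L =>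
    ((hF L L.2).1.comp L (hce.contMDiff L) :)
  have hgs : ContMDiff (𝓡 n) 𝓘(ℝ, Model) ∞ (Subtype.val ∘ g) := fun L =>
    ((hG L L.2).1.comp L (hde.contMDiff L) :)
  -- A continuous map into an immersed manifold is smooth once its composite with the immersion is;
  -- continuity holds because the inclusion is a topological embedding.
  have hfc : ContMDiff (𝓡 n) (𝓡 n) ∞ f := fun L =>
    (ContMDiffAt.iff_comp_isImmersionAt (hde.isImmersion.isImmersionAt (f L))).2
      ⟨(hde.isEmbedding.continuous_iff.2 hfs.continuous).continuousAt, hfs L⟩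
  have hgc : ContMDiff (𝓡 n) (𝓡 n) ∞ g := fun L =>
    (ContMDiffAt.iff_comp_isImmersionAt (hce.isImmersion.isImmersionAt (g L))).2
      ⟨(hce.isEmbedding.continuous_iff.2 hgs.continuous).continuousAt, hgs L⟩
  exact ⟨{ toFun := f
           invFun := g
           left_inv := fun L => Subtype.ext (hF L L.2).2.2
           right_inv := fun L => Subtype.ext (hG L L.2).2.2
           contMDiff_toFun := hfc
           contMDiff_invFun := hgc }⟩

/-! ### A distinguished chamber -/

/-- The open chamber where the zeroth coordinate dominates. -/
def dominantChamber : Set (Fin 4 → ℝ) :=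
  {x | ∑ k, x k = 2 ∧ x 0 < 1 ∧ ∀ j, j ≠ 0 → 0 < x j ∧ 1 < x 0 + x j}

/-- The vertices other than Λ_23 span a square pyramid with `y` in its interior: `y` is a convex
combination of all five with positive coefficients. If ⟨t, ·⟩ is at most ⟨t, y⟩ at each vertex,
equality holds at each, so all t_i agree, and their sum is zero. -/
theorem eq_zero_of_pyramid {t₀ t₁ t₂ t₃ y₀ y₁ y₂ y₃ : ℝ} (hy : y₀ + y₁ + y₂ + y₃ = 2)
    (h0 : y₀ < 1) (h1 : y₁ < 1) (h2 : 0 < y₂) (h3 : 0 < y₃) (h01 : 1 < y₀ + y₁)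
    (ht : t₀ + t₁ + t₂ + t₃ = 0)
    (g01 : t₀ + t₁ ≤ t₀ * y₀ + t₁ * y₁ + t₂ * y₂ + t₃ * y₃)
    (g02 : t₀ + t₂ ≤ t₀ * y₀ + t₁ * y₁ + t₂ * y₂ + t₃ * y₃)
    (g03 : t₀ + t₃ ≤ t₀ * y₀ + t₁ * y₁ + t₂ * y₂ + t₃ * y₃)
    (g12 : t₁ + t₂ ≤ t₀ * y₀ + t₁ * y₁ + t₂ * y₂ + t₃ * y₃)
    (g13 : t₁ + t₃ ≤ t₀ * y₀ + t₁ * y₁ + t₂ * y₂ + t₃ * y₃) :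
    t₀ = 0 ∧ t₁ = 0 ∧ t₂ = 0 ∧ t₃ = 0 := by
  obtain ⟨c, hc⟩ : ∃ c, c = t₀ * y₀ + t₁ * y₁ + t₂ * y₂ + t₃ * y₃ := ⟨_, rfl⟩
  rw [← hc] at g01 g02 g03 g12 g13
  have hs : 0 < y₂ + y₃ := by linarith
  obtain ⟨r, hr⟩ : ∃ r, r = (1 - y₀) / (y₂ + y₃) := ⟨_, rfl⟩
  have hr1 : r * (y₂ + y₃) = 1 - y₀ := by rw [hr]; field_simp
  have hr0 : 0 < r := by rw [hr]; exact div_pos (by linarith) hs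
  have hr2 : 0 < 1 - r := by
    rw [hr, sub_pos, div_lt_one hs]; linarith
  -- The coefficients are the barycentric weights of `y`: apex Λ_01 gets y₀ + y₁ − 1, and y₂, y₃ are
  -- split in the ratio (1 − r) : r between base vertices containing 0 and those containing 1; `r`
  -- is fixed by coordinate 0.
  have hsum : (y₀ + y₁ - 1) * (c - (t₀ + t₁)) + y₂ * (1 - r) * (c - (t₀ + t₂)) +
      y₃ * (1 - r) * (c - (t₀ + t₃)) + y₂ * r * (c - (t₁ + t₂)) + y₃ * r * (c - (t₁ + t₃)) = 0 := by
    have e1 : y₁ = 2 - y₀ - y₂ - y₃ := by linarith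
    subst e1
    rw [hc]
    linear_combination (t₀ - t₁) * hr1
  have a1 : 0 ≤ (y₀ + y₁ - 1) * (c - (t₀ + t₁)) :=
    mul_nonneg (by linarith) (by linarith)
  have a2 : 0 ≤ y₂ * (1 - r) * (c - (t₀ + t₂)) := mul_nonneg (by positivity) (by linarith)
  have a3 : 0 ≤ y₃ * (1 - r) * (c - (t₀ + t₃)) := mul_nonneg (by positivity) (by linarith)
  have a4 : 0 ≤ y₂ * r * (c - (t₁ + t₂)) := mul_nonneg (by positivity) (by linarith)
  have a5 : 0 ≤ y₃ * r * (c - (t₁ + t₃)) := mul_nonneg (by positivity) (by linarith)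
  have b1 := (mul_eq_zero.1 (show (y₀ + y₁ - 1) * (c - (t₀ + t₁)) = 0 by linarith)).resolve_left
    (by linarith)
  have b2 := (mul_eq_zero.1 (show y₂ * (1 - r) * (c - (t₀ + t₂)) = 0 by linarith)).resolve_left
    (by positivity)
  have b3 := (mul_eq_zero.1 (show y₃ * (1 - r) * (c - (t₀ + t₃)) = 0 by linarith)).resolve_left
    (by positivity)
  have b4 := (mul_eq_zero.1 (show y₂ * r * (c - (t₁ + t₂)) = 0 by linarith)).resolve_left
    (by positivity)
  refine ⟨?_, ?_, ?_, ?_⟩ <;> linarith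

theorem plucker_relation (A : Matrix (Fin 4) (Fin 2) ℂ) :
    rowDet A 0 1 * rowDet A 2 3 - rowDet A 0 2 * rowDet A 1 3 + rowDet A 0 3 * rowDet A 1 2 = 0 := by
  unfold rowDet
  ring

/-- Every plane over the chamber has all P^{0j} nonzero and at most one other Plücker coordinate
zero, so its polytope contains the octahedron with at most one vertex Λ_jk, j, k ≠ 0, removed. Each
such pyramid has `y` in its interior because y_0 + y_l > 1 for the remaining index l. -/
theorem stable_of_dominantChamber {x y : Fin 4 → ℝ} (hx : x ∈ dominantChamber)
    (hy : y ∈ dominantChamber) {L : Grassmannian} (hL : momentMap L = x) : Stable y L := by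
  intro A hA t ht hneg
  obtain ⟨hx2, hx0, hxj⟩ := hx
  obtain ⟨hy2, hy0, hyj⟩ := hy
  have hN := sum_pluckerWeight_pos hA
  have hr (k : Fin 4) : rowWeight A k = x k * ∑ I, pluckerWeight A I := by
    rw [← hL, momentMap_apply hA, div_mul_cancel₀ _ hN.ne']
  have r0 := hr 0
  have r1 := hr 1
  have r2 := hr 2
  have r3 := hr 3
  have s1 := mul_lt_mul_of_pos_right (hxj 1 (by decide)).2 hN
  have s2 := mul_lt_mul_of_pos_right (hxj 2 (by decide)).2 hN
  have s3 := mul_lt_mul_of_pos_right (hxj 3 (by decide)).2 hN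
  have s0 := mul_lt_mul_of_pos_right hx0 hN
  rw [one_mul, add_mul, ← r0] at s1 s2 s3
  rw [← r1] at s1
  rw [← r2] at s2
  rw [← r3] at s3
  rw [← r0, one_mul] at s0
  simp only [sum_pluckerWeight, rowWeight, Fin.sum_univ_four, rowDet_self, norm_zero,
    norm_rowDet_comm A 1 0, norm_rowDet_comm A 2 0, norm_rowDet_comm A 3 0,
    norm_rowDet_comm A 2 1, norm_rowDet_comm A 3 1, norm_rowDet_comm A 3 2] at s0 s1 s2 s3
  -- With N the sum of all |P^I|², (x_0 + x_1) N = N + |P^{01}|² − |P^{23}|², so x_0 + x_1 > 1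
  -- forces |P^{01}| > |P^{23}|; likewise for the other two.
  have n01 : rowDet A 0 1 ≠ 0 := by
    intro h; rw [h, norm_zero] at s1; nlinarith [sq_nonneg ‖rowDet A 2 3‖]
  have n02 : rowDet A 0 2 ≠ 0 := by
    intro h; rw [h, norm_zero] at s2; nlinarith [sq_nonneg ‖rowDet A 1 3‖]
  have n03 : rowDet A 0 3 ≠ 0 := by
    intro h; rw [h, norm_zero] at s3; nlinarith [sq_nonneg ‖rowDet A 1 2‖]
  have hP := plucker_relation A
  have key (i j : Fin 4) (hij : i < j) (h : rowDet A i j ≠ 0) :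
      t i + t j ≤ t 0 * y 0 + t 1 * y 1 + t 2 * y 2 + t 3 * y 3 := by
    have h1 := hneg ⟨(i, j), hij⟩ (by
      have : minor A ⟨(i, j), hij⟩ ≠ 0 := h
      simpa [pluckerWeight] using this)
    rw [dotProduct_sub, dotProduct_weight, dotProduct, Fin.sum_univ_four] at h1
    linarith
  have k01 := key 0 1 (by decide) n01
  have k02 := key 0 2 (by decide) n02
  have k03 := key 0 3 (by decide) n03
  obtain ⟨y1p, y01⟩ := hyj 1 (by decide)
  obtain ⟨y2p, y02⟩ := hyj 2 (by decide)
  obtain ⟨y3p, y03⟩ := hyj 3 (by decide)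
  rw [Fin.sum_univ_four] at hy2
  have ht' : t 0 + t 1 + t 2 + t 3 = 0 := by
    rwa [dotProduct_one, Fin.sum_univ_four] at ht
  suffices h : t 0 = 0 ∧ t 1 = 0 ∧ t 2 = 0 ∧ t 3 = 0 by
    ext k
    fin_cases k
    · exact h.1
    · exact h.2.1
    · exact h.2.2.1
    · exact h.2.2.2
  -- As the P^{0j} are nonzero, the Plücker relation forbids exactly two of P^{12}, P^{13}, P^{23}
  -- to vanish; all three vanishing would give x_0 = 1.
  by_cases h12 : rowDet A 1 2 = 0
  · have h13 : rowDet A 1 3 ≠ 0 := by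
      intro h13
      rw [h12, h13, mul_zero, mul_zero, sub_zero, add_zero] at hP
      have h23 := (mul_eq_zero.1 hP).resolve_left n01
      rw [h12, h13, h23, norm_zero] at s0
      linarith
    have h23 : rowDet A 2 3 ≠ 0 := by
      intro h23
      rw [h12, h23, mul_zero, mul_zero, zero_sub, add_zero, neg_eq_zero] at hP
      exact (mul_ne_zero n02 h13) hP
    have k13 := key 1 3 (by decide) h13
    have k23 := key 2 3 (by decide) h23
    have := eq_zero_of_pyramid (t₀ := t 0) (t₁ := t 3) (t₂ := t 1) (t₃ := t 2) (y₀ := y 0)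
      (y₁ := y 3) (y₂ := y 1) (y₃ := y 2) (by linarith) hy0 (by linarith) y1p y2p y03
      (by linarith) (by linarith) (by linarith) (by linarith) (by linarith) (by linarith)
    tauto
  have k12 := key 1 2 (by decide) h12
  by_cases h13 : rowDet A 1 3 = 0
  · have h23 : rowDet A 2 3 ≠ 0 := by
      intro h23
      rw [h13, h23, mul_zero, mul_zero, zero_sub, neg_zero, zero_add] at hP
      exact (mul_ne_zero n03 h12) hP
    have k23 := key 2 3 (by decide) h23
    have := eq_zero_of_pyramid (t₀ := t 0) (t₁ := t 2) (t₂ := t 1) (t₃ := t 3) (y₀ := y 0)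
      (y₁ := y 2) (y₂ := y 1) (y₃ := y 3) (by linarith) hy0 (by linarith) y1p y3p y02
      (by linarith) (by linarith) (by linarith) (by linarith) (by linarith) (by linarith)
    tauto
  have k13 := key 1 3 (by decide) h13
  exact eq_zero_of_pyramid hy2 hy0 (by linarith) y2p y3p y01 ht' k01 k02 k03 k12 k13

theorem levelEquiv_of_dominantChamber {x y : Fin 4 → ℝ} (hx : x ∈ dominantChamber)
    (hy : y ∈ dominantChamber) : LevelEquiv x y := by
  have key {x y : Fin 4 → ℝ} (hx : x ∈ dominantChamber) (hy : y ∈ dominantChamber)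
      (L : Grassmannian) (hL : momentMap L = x) :
      ContMDiffAt 𝓘(ℝ, Model) 𝓘(ℝ, Model) ∞ (flow y) L ∧ momentMap (flow y L) = y ∧
        flow x (flow y L) = L := by
    have h1 := stable_of_dominantChamber hx hy hL
    have h2 := momentMap_flow hy.1 h1
    exact ⟨contMDiffAt_flow hy.1 h1, h2,
      flow_flow hx.1 hy.1 hL h1 (stable_of_dominantChamber hy hx h2)⟩
  exact ⟨flow y, flow x, key hx hy, key hy hx⟩

/-! ### Level sets as submanifolds -/

/-- The column factor restores the identity block that the diagonal action has rescaled. -/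
theorem graphFrame_diag (t : Fin 4 → ℝ) (p : Split) (X : Model) (i : Fin 4) (k : Fin 2) :
    graphFrame p (fun b a => ((Real.exp ((t (p.symm (Sum.inr b)) -
      t (p.symm (Sum.inl a))) / 2) : ℝ) : ℂ) * X b a) i k =
    ((Real.exp (t i / 2) : ℝ) : ℂ) * graphFrame p X i k *
      ((Real.exp (-(t (p.symm (Sum.inl k)) / 2)) : ℝ) : ℂ) := by
  obtain ⟨s, rfl⟩ := p.symm.surjective i
  rcases s with a | b
  · rcases eq_or_ne a k with rfl | h
    · simp only [graphFrame, Matrix.of_apply, Equiv.apply_symm_apply, Sum.elim_inl,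
        Matrix.one_apply_eq, mul_one]
      rw [← Complex.ofReal_mul, ← Real.exp_add, add_neg_cancel, Real.exp_zero, Complex.ofReal_one]
    · simp [graphFrame, Matrix.one_apply_ne h]
  · simp only [graphFrame, Matrix.of_apply, Equiv.apply_symm_apply, Sum.elim_inr]
    rw [sub_div, sub_eq_add_neg, Real.exp_add, Complex.ofReal_mul]
    ring

theorem pluckerWeight_graphFrame_diag (t : Fin 4 → ℝ) (p : Split) (X : Model) (I : Pair) :
    pluckerWeight (graphFrame p fun b a => ((Real.exp ((t (p.symm (Sum.inr b)) -
      t (p.symm (Sum.inl a))) / 2) : ℝ) : ℂ) * X b a) I =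
    Real.exp (-(t (p.symm (Sum.inl 0)) + t (p.symm (Sum.inl 1)))) *
      (pluckerWeight (graphFrame p X) I * Real.exp (t ⬝ᵥ weight I)) := by
  rw [← pluckerWeight_diag]
  have h : minor (graphFrame p fun b a => ((Real.exp ((t (p.symm (Sum.inr b)) -
      t (p.symm (Sum.inl a))) / 2) : ℝ) : ℂ) * X b a) I =
      ((Real.exp (-(t (p.symm (Sum.inl 0)) + t (p.symm (Sum.inl 1))) / 2) : ℝ) : ℂ) *
        minor (Matrix.of fun i k => ((Real.exp (t i / 2) : ℝ) : ℂ) * graphFrame p X i k) I := by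
    rw [neg_add, add_div, Real.exp_add, Complex.ofReal_mul, neg_div, neg_div]
    simp only [minor, graphFrame_diag, Matrix.of_apply]
    ring
  rw [pluckerWeight, h, norm_mul, mul_pow, Complex.norm_real, Real.norm_eq_abs, sq_abs,
    ← Real.exp_nat_mul, pluckerWeight]
  congr 2
  push_cast
  ring

/-- Three of the four coordinates of `∑ |P^I|² (Λ_I - x)`, in an affine chart. -/
noncomputable def levelFun (x : Fin 4 → ℝ) (p : Split) (X : Model) : Fin 3 → ℝ :=
  fun j => ∑ I, pluckerWeight (graphFrame p X) I * (weight I j.succ - x j.succ)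

theorem contDiff_levelFun (x : Fin 4 → ℝ) (p : Split) : ContDiff ℝ ∞ (levelFun x p) := by
  rw [contDiff_pi]
  intro j
  refine ContDiff.sum fun I _ => ContDiff.mul ?_ contDiff_const
  exact (contDiff_pi.1 (contDiff_pluckerWeight p)) I

/-- Dropping one coordinate loses nothing: Λ_I and `x` both have coordinate sum 2, so the four
coordinates add up to zero. -/
theorem levelFun_eq_zero_iff {x : Fin 4 → ℝ} (hx : ∑ k, x k = 2) (p : Split) (X : Model) :
    levelFun x p X = 0 ↔ momentMap (graphPlane p X) = x := by
  rw [momentMap_eq_iff (isFrame_graphPlane p X)]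
  set V := ∑ I, pluckerWeight (graphFrame p X) I • (weight I - x) with hV
  have h1 : ∀ j, levelFun x p X j = V j.succ := by
    intro j
    simp [levelFun, hV]
  have h2 : ∑ k, V k = 0 := by
    rw [← one_dotProduct, hV, dotProduct_sum]
    simp only [dotProduct_smul, one_dotProduct_weight_sub hx, smul_zero, Finset.sum_const_zero]
  constructor
  · intro h
    have h3 : ∀ j : Fin 3, V j.succ = 0 := fun j => by rw [← h1, h]; rfl
    rw [Fin.sum_univ_succ] at h2
    simp only [h3, Finset.sum_const_zero, add_zero] at h2
    ext k
    refine Fin.cases h2 h3 k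
  · intro h
    ext j
    rw [h1, h]
    rfl

/-- Differentiating along the positive diagonal orbit already gives every direction: the derivative
is the Hessian of the exponential sum, injective by spanning and hence surjective. -/
theorem surjective_fderiv_levelFun {x : Fin 4 → ℝ} (hx : ∑ k, x k = 2) {p : Split} {X : Model}
    (hX : momentMap (graphPlane p X) = x)
    (hs : Spanning (fun I => weight I - x) 1 (pluckerWeight (graphFrame p X))) :
    Function.Surjective (fderiv ℝ (levelFun x p) X) := by
  intro w
  have hinj := hessian_injective (pluckerWeight_nonneg (graphFrame p X)) hs
  -- The zeroth entry makes the coordinates sum to zero; this forces `t` to be orthogonal to `1`, so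
  -- the penalty term drops out.
  obtain ⟨t, ht⟩ := LinearMap.surjective_of_injective hinj (Fin.cons (-∑ j, w j) w)
  have ht0 : t ⬝ᵥ 1 = 0 := by
    have h1 := congrArg (fun z => (1 : Fin 4 → ℝ) ⬝ᵥ z) ht
    simp only [hessian_apply, dotProduct_add, dotProduct_sum, dotProduct_smul,
      one_dotProduct_weight_sub hx, smul_zero, Finset.sum_const_zero, zero_add] at h1
    rw [one_dotProduct (Fin.cons _ _), Fin.sum_univ_succ] at h1
    simp only [Fin.cons_zero, Fin.cons_succ, neg_add_cancel, smul_eq_mul] at h1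
    exact (mul_eq_zero.1 h1).resolve_right one_dotProduct_one_ne_zero
  let γ : ℝ → Model := fun s b a => ((Real.exp (((s • t) (p.symm (Sum.inr b)) -
      (s • t) (p.symm (Sum.inl a))) / 2) : ℝ) : ℂ) * X b a
  have hγ0 : γ 0 = X := by
    ext b a
    simp [γ]
  have hγ : DifferentiableAt ℝ γ 0 := by
    rw [differentiableAt_pi]
    intro b
    rw [differentiableAt_pi]
    intro a
    refine DifferentiableAt.mul_const ?_ _
    refine Complex.ofRealCLM.differentiableAt.comp (0 : ℝ) ?_
    refine DifferentiableAt.exp ?_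
    simp only [Pi.smul_apply, smul_eq_mul]
    fun_prop
  refine ⟨deriv γ 0, ?_⟩
  have h1 : HasDerivAt (fun s => levelFun x p (γ s)) (fderiv ℝ (levelFun x p) X (deriv γ 0)) 0 :=
    (((contDiff_levelFun x p).differentiable (by simp) X).hasFDerivAt).comp_hasDerivAt_of_eq 0
      hγ.hasDerivAt hγ0.symm
  refine h1.unique ?_
  rw [hasDerivAt_pi]
  intro j
  -- Along the orbit the function is a positive scalar times an exponential sum. The sum vanishes at
  -- `s = 0`, so the derivative of the scalar contributes nothing.
  have hform : ∀ s : ℝ, levelFun x p (γ s) j =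
      Real.exp (s * (t ⬝ᵥ x - (t (p.symm (Sum.inl 0)) + t (p.symm (Sum.inl 1))))) *
      ∑ I, pluckerWeight (graphFrame p X) I * Real.exp (s * (t ⬝ᵥ (weight I - x))) *
        (weight I j.succ - x j.succ) := by
    intro s
    rw [Finset.mul_sum, levelFun]
    refine Finset.sum_congr rfl fun I _ => ?_
    simp only [γ]
    rw [pluckerWeight_graphFrame_diag]
    have hE : Real.exp (-((s • t) (p.symm (Sum.inl 0)) + (s • t) (p.symm (Sum.inl 1)))) *
        Real.exp ((s • t) ⬝ᵥ weight I) =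
        Real.exp (s * (t ⬝ᵥ x - (t (p.symm (Sum.inl 0)) + t (p.symm (Sum.inl 1))))) *
          Real.exp (s * (t ⬝ᵥ (weight I - x))) := by
      rw [← Real.exp_add, ← Real.exp_add]
      congr 1
      simp only [smul_dotProduct, dotProduct_sub, Pi.smul_apply, smul_eq_mul]
      ring
    linear_combination
      pluckerWeight (graphFrame p X) I * (weight I j.succ - x j.succ) * hE
  have hfun : (fun s => levelFun x p (γ s) j) = _ := funext hform
  rw [hfun]
  have e1 : HasDerivAt (fun s : ℝ => Real.exp (s * (t ⬝ᵥ x -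
      (t (p.symm (Sum.inl 0)) + t (p.symm (Sum.inl 1)))))) _ 0 :=
    ((hasDerivAt_id (0 : ℝ)).mul_const _).exp
  have e2 : HasDerivAt (fun s : ℝ => ∑ I, pluckerWeight (graphFrame p X) I *
      Real.exp (s * (t ⬝ᵥ (weight I - x))) * (weight I j.succ - x j.succ)) _ 0 :=
    HasDerivAt.fun_sum fun I _ => ((((hasDerivAt_id (0 : ℝ)).mul_const
      (t ⬝ᵥ (weight I - x))).exp).const_mul (pluckerWeight (graphFrame p X) I)).mul_const
        (weight I j.succ - x j.succ)
  refine (e1.mul e2).congr_deriv ?_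
  have hz := congrFun ((levelFun_eq_zero_iff hx p X).2 hX) j
  have ht' := congrFun ht j.succ
  rw [hessian_apply, ht0] at ht'
  simp only [levelFun, Pi.zero_apply] at hz
  simp only [zero_smul, add_zero, Finset.sum_apply, Pi.smul_apply, smul_eq_mul, Pi.sub_apply,
    Fin.cons_succ] at ht'
  simp only [id, zero_mul, Real.exp_zero, mul_one, one_mul, hz, mul_zero, zero_add]
  exact ht'

theorem exists_isSubmanifoldAtlas {x : Fin 4 → ℝ} (hx : ∑ k, x k = 2)
    (hs : ∀ L A, momentMap L = x → IsFrame L A →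
      Spanning (fun I => weight I - x) 1 (pluckerWeight A)) :
    ∃ c : ChartedSpace (EuclideanSpace ℝ (Fin 5)) (levelSet x),
      IsSubmanifoldAtlas 5 (levelSet x) c := by
  refine exists_isSmoothEmbedding_of_submersion (E := EuclideanSpace ℝ (Fin 5)) (E' := Model)
    (F := Fin 3 → ℝ) ?_ ?_
  · have : Module.finrank ℝ Model = 8 := by
      simp [Model, Module.finrank_pi_fintype, Complex.finrank_real_complex]
    rw [this]
    simp
  · intro L hL
    obtain ⟨p, X, rfl⟩ := exists_eq_graphPlane L
    refine ⟨chart p, chart_mem_maximalAtlas p, graphPlane_mem_chart_source p X, levelFun x p,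
      contDiff_levelFun x p, ?_, ?_⟩
    · rw [chart_graphPlane]
      exact surjective_fderiv_levelFun hx hL (hs _ _ hL (isFrame_graphPlane p X))
    · intro m hm
      rw [levelFun_eq_zero_iff hx, graphPlane_chart p hm]
      rfl

end Gr42

/-! ### Relative interiors of convex hulls of finite families. -/

section IntrinsicInterior

open Set Topology

variable {E : Type*} [NormedAddCommGroup E] [NormedSpace ℝ E] {s : Set E}

theorem mem_intrinsicInterior_iff_exists_nhds {x : E} :
    x ∈ intrinsicInterior ℝ s ↔
      x ∈ affineSpan ℝ s ∧ ∃ U ∈ 𝓝 x, U ∩ affineSpan ℝ s ⊆ s := by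
  rw [mem_intrinsicInterior]
  constructor
  · rintro ⟨y, hy, rfl⟩
    rw [mem_interior_iff_mem_nhds, mem_nhds_subtype] at hy
    obtain ⟨U, hU, hs⟩ := hy
    exact ⟨y.2, U, hU, fun z hz => hs (show (⟨z, hz.2⟩ : affineSpan ℝ s) ∈ _ from hz.1)⟩
  · rintro ⟨hx, U, hU, hs⟩
    refine ⟨⟨x, hx⟩, ?_, rfl⟩
    rw [mem_interior_iff_mem_nhds, mem_nhds_subtype]
    exact ⟨U, hU, fun z hz => hs ⟨hz, z.2⟩⟩

/-- The homothety of ratio ε centred at `y` maps `s` into itself and `z` to the combination; its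
inverse `φ` pulls a neighbourhood of `z` back to one of the image. -/
theorem Convex.combo_mem_intrinsicInterior (hs : Convex ℝ s) {z y : E}
    (hz : z ∈ intrinsicInterior ℝ s) (hy : y ∈ s) {ε : ℝ} (h0 : 0 < ε) (h1 : ε ≤ 1) :
    ε • z + (1 - ε) • y ∈ intrinsicInterior ℝ s := by
  have hzs := intrinsicInterior_subset hz
  rw [mem_intrinsicInterior_iff_exists_nhds] at hz ⊢
  obtain ⟨-, U, hU, hUs⟩ := hz
  set x := ε • z + (1 - ε) • y with hx
  have hxs : x ∈ affineSpan ℝ s :=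
    subset_affineSpan ℝ s (hs hzs hy h0.le (by linarith) (by ring))
  let φ : E → E := fun w => ε⁻¹ • (w - x) + z
  have hφ : ContinuousAt φ x := by fun_prop
  have hφx : φ x = z := by simp [φ]
  refine ⟨hxs, φ ⁻¹' U, hφ.preimage_mem_nhds (by rwa [hφx]), ?_⟩
  rintro w ⟨hwU, hws⟩
  have h2 : φ w ∈ s := hUs ⟨hwU, AffineSubspace.smul_vsub_vadd_mem _ ε⁻¹ hws hxs
    (subset_affineSpan ℝ s hzs)⟩
  have h3 : w = ε • φ w + (1 - ε) • y := by
    simp only [φ, smul_add, smul_smul, mul_inv_cancel₀ h0.ne', one_smul]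
    rw [hx]
    abel
  rw [h3]
  exact hs h2 hy h0.le (by linarith) (by ring)

/-- A combination with positive coefficients of finitely many points lies in the relative interior
of their convex hull. -/
theorem sum_smul_mem_intrinsicInterior_convexHull [FiniteDimensional ℝ E] {ι : Type*}
    [Fintype ι] (v : ι → E) (σ : Set ι)
    {w : ι → ℝ} (hpos : ∀ i ∈ σ, 0 < w i) (hzero : ∀ i ∉ σ, w i = 0) (hsum : ∑ i, w i = 1) :
    ∑ i, w i • v i ∈ intrinsicInterior ℝ (convexHull ℝ (v '' σ)) := by
  classical
  have hσ : σ.Nonempty := by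
    by_contra h
    rw [not_nonempty_iff_eq_empty] at h
    have : ∑ i, w i = 0 := Finset.sum_eq_zero fun i _ => hzero i (by simp [h])
    rw [hsum] at this
    exact one_ne_zero this
  have hcomb : ∀ u : ι → ℝ, (∀ i, 0 ≤ u i) → (∀ i ∉ σ, u i = 0) → ∑ i, u i = 1 →
      ∑ i, u i • v i ∈ convexHull ℝ (v '' σ) := by
    intro u hu hu0 hu1
    rw [← Finset.sum_subset (Finset.subset_univ (Finset.univ.filter (· ∈ σ))) fun i _ hi => by
      rw [hu0 i (by simpa using hi), zero_smul]]
    refine (convex_convexHull ℝ _).sum_mem (fun i _ => hu i) ?_ fun i hi => ?_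
    · rw [← hu1]
      exact Finset.sum_subset (Finset.subset_univ _) fun i _ hi => hu0 i (by simpa using hi)
    · exact subset_convexHull ℝ _ ⟨i, by simpa using hi, rfl⟩
  have hsub : convexHull ℝ (v '' σ) ⊆ {z | ∃ u : ι → ℝ, (∀ i, 0 ≤ u i) ∧ (∀ i ∉ σ, u i = 0) ∧
      ∑ i, u i = 1 ∧ z = ∑ i, u i • v i} := by
    refine convexHull_min ?_ ?_
    · rintro _ ⟨i, hi, rfl⟩
      refine ⟨Pi.single i 1, fun j => ?_, fun j hj => ?_, by simp, ?_⟩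
      · by_cases h : j = i
        · subst h; simp
        · simp [h]
      · have : j ≠ i := fun h => hj (h ▸ hi)
        simp [this]
      · simp [Pi.single_apply, ite_smul]
    · rintro _ ⟨u, a1, a2, a3, rfl⟩ _ ⟨u', b1, b2, b3, rfl⟩ a b ha hb hab
      refine ⟨a • u + b • u', fun i => ?_, fun i hi => ?_, ?_, ?_⟩
      · exact add_nonneg (mul_nonneg ha (a1 i)) (mul_nonneg hb (b1 i))
      · simp [a2 i hi, b2 i hi]
      · simp only [Pi.add_apply, Pi.smul_apply, smul_eq_mul, Finset.sum_add_distrib,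
          ← Finset.mul_sum, a3, b3, mul_one, hab]
      · simp only [Pi.add_apply, Pi.smul_apply, smul_eq_mul, add_smul, mul_smul,
          Finset.sum_add_distrib, Finset.smul_sum]
  have hconv := convex_convexHull ℝ (v '' σ)
  -- Take any relative interior point `z` and write the given point as ε z + (1 − ε) y with `y`
  -- still in the hull.
  obtain ⟨z, hz⟩ := Set.Nonempty.intrinsicInterior hconv ((hσ.image v).convexHull)
  obtain ⟨u, hu, hu0, hu1, hzu⟩ := hsub (intrinsicInterior_subset hz)
  obtain ⟨i₀, hi₀, hmin⟩ := Finset.exists_min_image (Finset.univ.filter (· ∈ σ)) w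
    (by obtain ⟨i, hi⟩ := hσ; exact ⟨i, by simpa using hi⟩)
  have hw0 : 0 < w i₀ := hpos _ (by simpa using hi₀)
  have hw1 : w i₀ ≤ 1 := by
    rw [← hsum]
    refine Finset.single_le_sum (f := w) (fun i _ => ?_) (Finset.mem_univ i₀)
    by_cases h : i ∈ σ
    · exact (hpos i h).le
    · exact (hzero i h).ge
  have hu_le : ∀ i, u i ≤ 1 := fun i => by
    rw [← hu1]
    exact Finset.single_le_sum (f := u) (fun i _ => hu i) (Finset.mem_univ i)
  -- The coefficients of `z` are at most 1, so with ε below the least positive weight those of `y`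
  -- stay nonnegative; halving also keeps ε < 1.
  obtain ⟨ε, hε⟩ : ∃ ε, ε = w i₀ / 2 := ⟨_, rfl⟩
  have hε0 : 0 < ε := by linarith
  have hε1 : 0 < 1 - ε := by linarith
  let y : ι → ℝ := fun i => (1 - ε)⁻¹ * (w i - ε * u i)
  have hy : ∑ i, y i • v i ∈ convexHull ℝ (v '' σ) := by
    refine hcomb y (fun i => ?_) (fun i hi => ?_) ?_
    · refine mul_nonneg (by positivity) ?_
      by_cases h : i ∈ σ
      · have h1 := hmin i (by simpa using h)
        nlinarith [hu_le i, hu i]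
      · rw [hzero i h, hu0 i h]; simp
    · simp [y, hzero i hi, hu0 i hi]
    · simp only [y, ← Finset.mul_sum, Finset.sum_sub_distrib, hsum, hu1, mul_one]
      exact inv_mul_cancel₀ hε1.ne'
  have hfin := hconv.combo_mem_intrinsicInterior hz hy hε0 (by linarith)
  convert! hfin using 1
  rw [hzu, Finset.smul_sum, Finset.smul_sum, ← Finset.sum_add_distrib]
  refine Finset.sum_congr rfl fun i _ => ?_
  rw [smul_smul, smul_smul, ← add_smul]
  congr 1
  simp only [y]
  rw [mul_inv_cancel_left₀ hε1.ne']
  ring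

end IntrinsicInterior

namespace Gr42

open Set ExpSum

/-! ### Maximal chambers -/

theorem momentMap_mem_intrinsicInterior (L : Grassmannian) :
    momentMap L ∈ intrinsicInterior ℝ (polytope {I | plucker L I ≠ 0}) := by
  have hN : 0 < ∑ I, ‖plucker L I‖ ^ 2 := sum_pluckerWeight_pos (isFrame_frame L)
  have h : momentMap L = ∑ I, ((∑ J, ‖plucker L J‖ ^ 2)⁻¹ * ‖plucker L I‖ ^ 2) • weight I := by
    rw [momentMap, Finset.smul_sum]
    exact Finset.sum_congr rfl fun I _ => smul_smul _ _ _
  rw [h]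
  refine sum_smul_mem_intrinsicInterior_convexHull weight _ (fun I hI => ?_) (fun I hI => ?_) ?_
  · have : 0 < ‖plucker L I‖ := norm_pos_iff.2 hI
    positivity
  · have : plucker L I = 0 := by simpa using hI
    simp [this]
  · rw [← Finset.mul_sum, inv_mul_cancel₀ hN.ne']

/-- If t_i ≠ t_j, then `t` and `1` are independent, and two independent equations would leave
dimension at most 2. -/
theorem eq_of_finrank_vectorSpan {C : Set (Fin 4 → ℝ)} {t : Fin 4 → ℝ} {c : ℝ}
    (hC : Module.finrank ℝ (vectorSpan ℝ C) = 3) (h2 : ∀ z ∈ C, ∑ k, z k = 2)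
    (ht : ∀ z ∈ C, t ⬝ᵥ z = c) (i j : Fin 4) : t i = t j := by
  by_contra hne
  let φ : (Fin 4 → ℝ) →ₗ[ℝ] ℝ × ℝ :=
    (dotProductBilin ℝ ℝ 1).prod (dotProductBilin ℝ ℝ t)
  have hφ : ∀ z, φ z = (1 ⬝ᵥ z, t ⬝ᵥ z) := fun z => rfl
  have hle : vectorSpan ℝ C ≤ LinearMap.ker φ := by
    rw [vectorSpan_def, Submodule.span_le]
    rintro _ ⟨z, hz, z', hz', rfl⟩
    have : φ z = φ z' := by
      rw [hφ, hφ, one_dotProduct, one_dotProduct, h2 z hz, h2 z' hz', ht z hz, ht z' hz']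
    simp [this]
  have hsurj : Function.Surjective φ := by
    rintro ⟨a, b⟩
    have hd : t i - t j ≠ 0 := sub_ne_zero.2 hne
    refine ⟨Pi.single i ((b - a * t j) / (t i - t j)) +
      Pi.single j ((a * t i - b) / (t i - t j)), ?_⟩
    rw [hφ, dotProduct_add, dotProduct_add, dotProduct_single, dotProduct_single,
      dotProduct_single, dotProduct_single, Pi.one_apply, Pi.one_apply]
    ext
    · simp only
      field_simp
      ring
    · simp only
      field_simp
      ring
  have h3 := φ.finrank_range_add_finrank_ker
  rw [LinearMap.range_eq_top.2 hsurj, finrank_top, Module.finrank_prod] at h3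
  have h4 := Submodule.finrank_mono hle
  simp at h3
  omega

theorem polytope_subset (σ : Set Pair) {D : Set (Fin 4 → ℝ)} (hD : Convex ℝ D)
    (h : ∀ I ∈ σ, weight I ∈ D) : polytope σ ⊆ D :=
  convexHull_min (by rintro _ ⟨I, hI, rfl⟩; exact h I hI) hD

theorem convex_dotProduct_eq (t : Fin 4 → ℝ) (c : ℝ) : Convex ℝ {z | t ⬝ᵥ z = c} :=
  convex_hyperplane (dotProductBilin ℝ ℝ t).isLinear c

theorem polytope_subset_cube (σ : Set Pair) :
    polytope σ ⊆ {z | ∑ k, z k = 2 ∧ ∀ k, 0 ≤ z k ∧ z k ≤ 1} := by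
  refine polytope_subset σ ?_ fun I _ => ⟨sum_weight I, fun k => ?_⟩
  · have h1 : Convex ℝ {z : Fin 4 → ℝ | ∑ k, z k = 2} := by
      simpa only [one_dotProduct] using convex_dotProduct_eq 1 2
    refine h1.inter (t := {z : Fin 4 → ℝ | ∀ k, 0 ≤ z k ∧ z k ≤ 1}) ?_
    have h2 : {z : Fin 4 → ℝ | ∀ k, 0 ≤ z k ∧ z k ≤ 1} = Icc 0 1 := by
      ext z
      simp only [mem_Icc, Pi.le_def, Set.mem_ofPred_eq]
      exact ⟨fun h => ⟨fun k => (h k).1, fun k => (h k).2⟩, fun h k => ⟨h.1 k, h.2 k⟩⟩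
    rw [h2]
    exact convex_Icc 0 1
  · unfold weight
    split_ifs <;> norm_num

theorem IsMaximalChamber.subset_cube {C : Set (Fin 4 → ℝ)} (hC : IsMaximalChamber C) :
    C ⊆ {z | ∑ k, z k = 2 ∧ ∀ k, 0 ≤ z k ∧ z k ≤ 1} := by
  obtain ⟨⟨-, w, -, rfl, -⟩, hdim⟩ := hC
  -- The empty family has intersection all of ℝ⁴, of dimension 4 rather than 3.
  rcases w.eq_empty_or_nonempty with rfl | ⟨σ, hσ⟩
  · rw [biInter_empty, ← direction_affineSpan, AffineSubspace.span_univ,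
      AffineSubspace.direction_top, finrank_top, Module.finrank_fin_fun] at hdim
    norm_num at hdim
  · exact (biInter_subset_of_mem hσ).trans
      (intrinsicInterior_subset.trans (polytope_subset_cube σ))

/-- Over a maximal chamber, the weights of a plane affinely span the hyperplane `∑ x_k = 2`. -/
theorem IsMaximalChamber.eq_of_support {C : Set (Fin 4 → ℝ)} (hC : IsMaximalChamber C)
    {L : Grassmannian} (hL : momentMap L ∈ C) {t : Fin 4 → ℝ} {c : ℝ}
    (ht : ∀ I, plucker L I ≠ 0 → t ⬝ᵥ weight I = c) (i j : Fin 4) : t i = t j := by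
  have hcube := hC.subset_cube
  obtain ⟨⟨-, w, -, hCw, hdisj⟩, hdim⟩ := hC
  -- The polytope of `L` has μ(L) in its relative interior, so it meets the chamber and must belong
  -- to the defining family; the chamber then lies inside it.
  have hσ : {I | plucker L I ≠ 0} ∈ w := by
    by_contra hσ
    exact disjoint_left.1 (hdisj _ ⟨L, fun I => Iff.rfl⟩ hσ) hL (momentMap_mem_intrinsicInterior L)
  have hsub : C ⊆ {z | t ⬝ᵥ z = c} := by
    rw [hCw]
    exact (biInter_subset_of_mem hσ).trans (intrinsicInterior_subset.trans
      (polytope_subset _ (convex_dotProduct_eq t c) ht))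
  exact eq_of_finrank_vectorSpan hdim (fun z hz => (hcube hz).1) hsub i j

/-- A `t` annihilating all Λ_I − x in the support is constant on the support's polytope, hence on
the chamber, so its coordinates agree; orthogonality to `1` makes them zero. -/
theorem IsMaximalChamber.spanning {C : Set (Fin 4 → ℝ)} (hC : IsMaximalChamber C)
    {x : Fin 4 → ℝ} (hx : x ∈ C) {L : Grassmannian} {A : Matrix (Fin 4) (Fin 2) ℂ}
    (hL : momentMap L = x) (hA : IsFrame L A) :
    Spanning (fun I => weight I - x) 1 (pluckerWeight A) := by
  intro t ht h
  obtain ⟨c, hc, hpl⟩ := plucker_eq hA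
  have h1 := hC.eq_of_support (hL ▸ hx) (t := t) (c := t ⬝ᵥ x) fun I hI => by
    have h2 := h I (by simp [pluckerWeight, hpl, hc, hI])
    rwa [dotProduct_sub, sub_eq_zero] at h2
  rw [dotProduct_one, Fin.sum_univ_four, h1 1 0, h1 2 0, h1 3 0] at ht
  ext k
  rw [h1 k 0, Pi.zero_apply]
  linarith

/-- A plane which is the sum of two lines in complementary coordinate subspaces. -/
theorem exists_momentMap_eq_of_sum_eq_one {x : Fin 4 → ℝ} (hx2 : ∑ k, x k = 2)
    (hx0 : ∀ k, 0 ≤ x k) (S : Finset (Fin 4)) (hS : ∑ k ∈ S, x k = 1) :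
    ∃ L, momentMap L = x ∧ ∀ I, plucker L I ≠ 0 → (I.1.1 ∈ S ↔ I.1.2 ∉ S) := by
  -- The two columns are the vectors √x_k supported on `S` and on its complement. Both sums being 1,
  -- they are orthonormal, and the row weights are exactly x_k.
  let r : Fin 4 → ℂ := fun k => (Real.sqrt (x k) : ℂ)
  have hrr : ∀ k, r k * r k = (x k : ℂ) := fun k => by
    simp only [r]
    rw [← Complex.ofReal_mul, Real.mul_self_sqrt (hx0 k)]
  have hrn : ∀ k, ‖r k‖ ^ 2 = x k := fun k => by
    simp only [r]
    rw [Complex.norm_real, Real.norm_eq_abs, sq_abs, Real.sq_sqrt (hx0 k)]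
  let A : Matrix (Fin 4) (Fin 2) ℂ := Matrix.of fun k a =>
    if k ∈ S then (if a = 0 then r k else 0) else (if a = 0 then 0 else r k)
  have hSc : ∑ k ∈ Sᶜ, x k = 1 := by
    have := Finset.sum_add_sum_compl S x
    linarith
  have hin : ∀ f : Fin 4 → ℝ, ∑ k, (if k ∈ S then f k else 0) = ∑ k ∈ S, f k := fun f => by
    rw [Finset.sum_ite_mem, Finset.univ_inter]
  have hout : ∀ f : Fin 4 → ℝ, ∑ k, (if k ∈ S then 0 else f k) = ∑ k ∈ Sᶜ, f k := fun f => by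
    rw [← Finset.univ_inter Sᶜ, ← Finset.sum_ite_mem]
    exact Finset.sum_congr rfl fun k _ => by by_cases h : k ∈ S <;> simp [h]
  have hAA : A.transpose * A = 1 := by
    ext a b
    rw [Matrix.mul_apply]
    fin_cases a <;> fin_cases b
    · have : ∀ k, A.transpose 0 k * A k 0 = ((if k ∈ S then x k else 0 : ℝ) : ℂ) := fun k => by
        by_cases h : k ∈ S <;> simp [A, h, hrr]
      simp only [Fin.zero_eta, this, ← Complex.ofReal_sum, hin, hS]
      simp
    · have : ∀ k, A.transpose 0 k * A k 1 = 0 := fun k => by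
        by_cases h : k ∈ S <;> simp [A, h]
      simp only [Fin.zero_eta, Fin.mk_one, this, Finset.sum_const_zero]
      simp
    · have : ∀ k, A.transpose 1 k * A k 0 = 0 := fun k => by
        by_cases h : k ∈ S <;> simp [A, h]
      simp only [Fin.zero_eta, Fin.mk_one, this, Finset.sum_const_zero]
      simp
    · have : ∀ k, A.transpose 1 k * A k 1 = ((if k ∈ S then 0 else x k : ℝ) : ℂ) := fun k => by
        by_cases h : k ∈ S <;> simp [A, h, hrr]
      simp only [Fin.mk_one, this, ← Complex.ofReal_sum, hout, hSc]
      simp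
  have hinj : Function.Injective A.mulVec := by
    intro c d hcd
    have := congrArg A.transpose.mulVec hcd
    simpa [Matrix.mulVec_mulVec, hAA] using this
  have hF : IsFrame (ofFrame A hinj) A := rfl
  have hdet : ∀ k l, ‖rowDet A k l‖ ^ 2 =
      if k ∈ S then x k * (if l ∈ S then 0 else x l) else x k * (if l ∈ S then x l else 0) := by
    intro k l
    by_cases hk : k ∈ S <;> by_cases hl : l ∈ S <;>
      simp [rowDet, A, hk, hl, mul_pow, hrn]
  have hrow : ∀ k, rowWeight A k = x k := by
    intro k
    simp only [rowWeight, hdet]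
    by_cases hk : k ∈ S
    · simp only [hk, if_true, ← Finset.mul_sum, hout, hSc, mul_one]
    · simp only [hk, if_false, ← Finset.mul_sum, hin, hS, mul_one]
  refine ⟨ofFrame A hinj, ?_, fun I hI => ?_⟩
  · have h1 := sum_rowWeight A
    simp only [hrow, hx2] at h1
    ext k
    rw [momentMap_apply hF, hrow, show ∑ I, pluckerWeight A I = 1 by linarith, div_one]
  · obtain ⟨c, hc, hpl⟩ := plucker_eq hF
    have h1 : rowDet A I.1.1 I.1.2 ≠ 0 := by
      change minor A I ≠ 0
      rw [hpl]
      exact mul_ne_zero hc hI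
    have h2 := hdet I.1.1 I.1.2
    by_cases hk : I.1.1 ∈ S <;> by_cases hl : I.1.2 ∈ S <;> simp [hk, hl] at h2 ⊢ <;>
      exact h1 h2

/-- Otherwise some plane over `x` has only pairs separated by `S` in its support, so the indicator
of `S` is constantly 1 there. Over a maximal chamber that makes `S` empty or everything, with sums 0
or 2. -/
theorem IsMaximalChamber.sum_ne_one {C : Set (Fin 4 → ℝ)} (hC : IsMaximalChamber C)
    {x : Fin 4 → ℝ} (hx : x ∈ C) (S : Finset (Fin 4)) : ∑ k ∈ S, x k ≠ 1 := by
  intro hS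
  obtain ⟨h2, h01⟩ := hC.subset_cube hx
  obtain ⟨L, hL, hsupp⟩ := exists_momentMap_eq_of_sum_eq_one h2 (fun k => (h01 k).1) S hS
  have h1 := hC.eq_of_support (hL ▸ hx) (t := fun k => if k ∈ S then 1 else 0) (c := 1)
    fun I hI => by
      have := hsupp I hI
      rw [dotProduct_weight]
      by_cases h : I.1.2 ∈ S <;> simp [h] at this <;> simp [h, this]
  by_cases h0 : (0 : Fin 4) ∈ S
  · have : S = Finset.univ := by
      ext k
      have := h1 k 0
      simpa [h0] using this
    rw [this, h2] at hS
    norm_num at hS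
  · have : S = ∅ := by
      ext k
      have := h1 k 0
      simpa [h0] using this
    rw [this] at hS
    simp at hS

/-- If x_i = 0, then 1 − x has sum 1 over {i}, so there is a plane over it and its dual lies over
`x`. No pair in the dual's support contains i, which confines the chamber to z_i = 0. -/
theorem IsMaximalChamber.pos {C : Set (Fin 4 → ℝ)} (hC : IsMaximalChamber C)
    {x : Fin 4 → ℝ} (hx : x ∈ C) (i : Fin 4) : 0 < x i := by
  obtain ⟨h2, h01⟩ := hC.subset_cube hx
  refine lt_of_le_of_ne (h01 i).1 fun hi => ?_
  obtain ⟨L', hL', -⟩ := exists_momentMap_eq_of_sum_eq_one (x := 1 - x)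
    (by simp [Finset.sum_sub_distrib, h2]; norm_num)
    (fun k => by simpa using (h01 k).2) {i} (by simp [← hi])
  have hL : momentMap (dual L') = x := by rw [momentMap_dual, hL', sub_sub_cancel]
  have hA := isFrame_frame (dual L')
  have hrow : rowWeight (frame (dual L')) i = 0 := by
    have h3 := momentMap_apply hA i
    rw [hL, ← hi] at h3
    exact (div_eq_zero_iff.1 h3.symm).resolve_right (sum_pluckerWeight_pos hA).ne'
  have hdet : ∀ j, rowDet (frame (dual L')) i j = 0 := fun j => by
    have := (Finset.sum_eq_zero_iff_of_nonneg fun j _ =>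
      sq_nonneg ‖rowDet (frame (dual L')) i j‖).1 hrow j (Finset.mem_univ j)
    simpa using this
  have h1 := hC.eq_of_support (L := dual L') (by rwa [hL]) (t := fun k => if k = i then 1 else 0)
    (c := 0) fun I hI => by
      have e1 : I.1.1 ≠ i := by
        intro h
        apply hI
        change rowDet (frame (dual L')) I.1.1 I.1.2 = 0
        rw [h, hdet]
      have e2 : I.1.2 ≠ i := by
        intro h
        apply hI
        change rowDet (frame (dual L')) I.1.1 I.1.2 = 0
        rw [rowDet_comm, h, hdet, neg_zero]
      simp [dotProduct_weight, e1, e2]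
  have h3 := h1 i (i + 1)
  have h4 : i + 1 ≠ i := by simp
  simp [h4] at h3

theorem comp_swap_mem_dominantChamber {x : Fin 4 → ℝ} (hx2 : ∑ k, x k = 2) {i : Fin 4}
    (hi : x i < 1) (h : ∀ j, j ≠ i → 1 < x i + x j) :
    x ∘ Equiv.swap 0 i ∈ dominantChamber := by
  have h0 : (x ∘ Equiv.swap 0 i) 0 = x i := by simp
  refine ⟨by rw [← hx2]; exact Equiv.sum_comp (Equiv.swap 0 i) x, by rwa [h0], fun j hj => ?_⟩
  have hj' : Equiv.swap 0 i j ≠ i := by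
    intro h
    apply hj
    rw [Equiv.swap_apply_eq_iff, Equiv.swap_apply_right] at h
    exact h
  have := h _ hj'
  rw [h0]
  exact ⟨by simp only [Function.comp]; linarith, this⟩

/-- The level set over a point of a maximal chamber is equivalent to one over the distinguished
chamber. -/
theorem IsMaximalChamber.exists_levelEquiv {C : Set (Fin 4 → ℝ)} (hC : IsMaximalChamber C)
    {x : Fin 4 → ℝ} (hx : x ∈ C) : ∃ y ∈ dominantChamber, LevelEquiv x y := by
  obtain ⟨h2, h01⟩ := hC.subset_cube hx
  have hlt : ∀ i, x i < 1 := fun i =>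
    lt_of_le_of_ne (h01 i).2 (by simpa using hC.sum_ne_one hx {i})
  have hpos := hC.pos hx
  have hlong : ∀ i, (∀ j, j ≠ i → 1 < x i + x j) → ∃ y ∈ dominantChamber, LevelEquiv x y :=
    fun i hi => ⟨_, comp_swap_mem_dominantChamber h2 (hlt i) hi, levelEquiv_perm _ x⟩
  have hshort : ∀ i, (∀ j, j ≠ i → x i + x j < 1) → ∃ y ∈ dominantChamber, LevelEquiv x y := by
    intro i hi
    refine ⟨_, comp_swap_mem_dominantChamber (x := 1 - x) (i := i) ?_ ?_ fun j hj => ?_,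
      (levelEquiv_one_sub x).trans (levelEquiv_perm _ _)⟩
    · simp [Finset.sum_sub_distrib, h2]; norm_num
    · simpa using hpos i
    · have := hi j hj
      simp only [Pi.sub_apply, Pi.one_apply]
      linarith
  -- Since the coordinates sum to 2, these three comparisons decide all six. Each of the eight
  -- patterns has an index whose three sums are all above 1 or all below 1; the latter is reduced to
  -- the former by duality.
  have n1 : x 0 + x 1 ≠ 1 := by simpa using hC.sum_ne_one hx {0, 1}
  have n2 : x 0 + x 2 ≠ 1 := by simpa using hC.sum_ne_one hx {0, 2}
  have n3 : x 0 + x 3 ≠ 1 := by simpa using hC.sum_ne_one hx {0, 3}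
  rw [Fin.sum_univ_four] at h2
  rcases n1.lt_or_gt with g1 | g1 <;> rcases n2.lt_or_gt with g2 | g2 <;>
    rcases n3.lt_or_gt with g3 | g3
  · exact hshort 0 fun j hj => by fin_cases j <;> simp at hj ⊢ <;> linarith
  · exact hlong 3 fun j hj => by fin_cases j <;> simp at hj ⊢ <;> linarith
  · exact hlong 2 fun j hj => by fin_cases j <;> simp at hj ⊢ <;> linarith
  · exact hshort 1 fun j hj => by fin_cases j <;> simp at hj ⊢ <;> linarith
  · exact hlong 1 fun j hj => by fin_cases j <;> simp at hj ⊢ <;> linarith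
  · exact hshort 2 fun j hj => by fin_cases j <;> simp at hj ⊢ <;> linarith
  · exact hshort 3 fun j hj => by fin_cases j <;> simp at hj ⊢ <;> linarith
  · exact hlong 0 fun j hj => by fin_cases j <;> simp at hj ⊢ <;> linarith

end Gr42

theorem mainTheorem7 :
    (∀ (C : Set (Fin 4 → ℝ)), Gr42.IsMaximalChamber C → ∀ x ∈ C,
      ∃ c : ChartedSpace (EuclideanSpace ℝ (Fin 5)) (Gr42.levelSet x),
        Gr42.IsSubmanifoldAtlas 5 (Gr42.levelSet x) c) ∧
    (∀ (C D : Set (Fin 4 → ℝ)), Gr42.IsMaximalChamber C → Gr42.IsMaximalChamber D →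
      ∀ x ∈ C, ∀ y ∈ D,
      ∀ (c : ChartedSpace (EuclideanSpace ℝ (Fin 5)) (Gr42.levelSet x))
        (d : ChartedSpace (EuclideanSpace ℝ (Fin 5)) (Gr42.levelSet y)),
        Gr42.IsSubmanifoldAtlas 5 (Gr42.levelSet x) c → Gr42.IsSubmanifoldAtlas 5 (Gr42.levelSet y) d →
          Nonempty (Diffeomorph (𝓡 5) (𝓡 5) (Gr42.levelSet x) (Gr42.levelSet y) ∞)) := by
  refine ⟨fun C hC x hx => Gr42.exists_isSubmanifoldAtlas (hC.subset_cube hx).1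
    fun L A hL hA => hC.spanning hx hL hA, fun C D hC hD x hx y hy c d hc hd => ?_⟩
  obtain ⟨x', hx', h1⟩ := hC.exists_levelEquiv hx
  obtain ⟨y', hy', h2⟩ := hD.exists_levelEquiv hy
  -- Symmetries bring both fibres over the model chamber, where the flow joins them.
  exact ((h1.trans (Gr42.levelEquiv_of_dominantChamber hx' hy')).trans
    h2.symm).nonempty_diffeomorph c d hc hd
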